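/- For $x\in\mathbb{R}^n$, let $x_{\mathrm{tail}(k)}$ denote $x$ with its $k$ largest coordinates (in absolute value) replaced by $0$. One *Count-Sketch* of $x$ with $R$ rows and $C$ columns chooses, for each row $u\in[R]$, a hash function $h_u:[n]\to[C]$ and a sign function $s_u:[n]\to\{\pm1\}$, all fully random (uniform and independent), forms $y_{u,v}=\sum_{i:h_u(i)=v}s_u(i)x_i$, and returns the estimate with coordinates $\operatorname{median}_{u\in[R]}\, s_u(i)\,y_{u,h_u(i)}$. (The median of an even number of reals is the midpoint of the two middle values.) Fix a real $t>0$, a positive integer $d$ and a real $\rho>0$. There are positive constants $c_0$ and $A$, depending only on $t,d,\rho$, such that the following holds for all $n\ge 0$, $k\ge 1$, $x\in\mathbb{R}^n$, all real $c\ge c_0$ for which $C=ck$ is an integer, all $R\ge\rho\log k$, and every nonempty set $S\subseteq[n]$ with $|S|\le k$. Let $\widehat{x}$ be the coordinate-wise median of the estimates of $x$ produced by $56d$ independent Count-Sketches, each with $R$ rows and $C=ck$ columns. Then $$\Pr\left[\|\widehat{x}_S-x_S\|_2^2> t\cdot|S|\cdot\frac1R\cdot\frac{\|x_{\mathrm{tail}(k)}\|_2^2}{k}\right]\le\frac{A}{|S|^d}.$$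 (In the degenerate case $R=0$, which forces $k=1$, the right-hand side inside the probability is read as $0$ and the estimate of each Count-Sketch as $0$.) -/

import Mathlib

open MeasureTheory ProbabilityTheory

/-- The median of a finite list of reals: the middle order statistic if `m` is odd, the midpoint
of the two middle order statistics if `m` is even (and `0` for the empty list). -/
noncomputable def median {m : ℕ} (f : Fin m → ℝ) : ℝ :=
  if h : 0 < m then
    (f (Tuple.sort f ⟨(m - 1) / 2, by omega⟩) + f (Tuple.sort f ⟨m / 2, by omega⟩)) / 2
  else 0

/-- The vector obtained from `x` by replacing its `k` largest coordinates (in absolute value, ties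
broken by the index) with `0`. The permutation `Tuple.sort (fun j => -|x j|)` sends a rank to the
coordinate of that rank, in decreasing order of absolute value. -/
noncomputable def tail {n : ℕ} (k : ℕ) (x : Fin n → ℝ) (i : Fin n) : ℝ :=
  if ((Tuple.sort fun j => -|x j|).symm i : ℕ) < k then 0 else x i

/-- The random choices of one Count-Sketch with `R` rows and `C` columns of a vector in `ℝⁿ`: in
each row `u` a hash function `h u : [n] → [C]` and a sign function `s u : [n] → {±1}`. -/
abbrev CountSketchSeed (n R C : ℕ) : Type :=
  (Fin R → Fin n → Fin C) × (Fin R → Fin n → ℤˣ)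

namespace CountSketchSeed

variable {n R C : ℕ}

/-- The sketch `y_{u,v} = ∑_{i : h_u(i) = v} s_u(i) x_i`. -/
noncomputable def sketch (ω : CountSketchSeed n R C) (x : Fin n → ℝ) (u : Fin R) (v : Fin C) : ℝ :=
  ∑ i with ω.1 u i = v, ((ω.2 u i : ℤ) : ℝ) * x i

/-- The Count-Sketch estimate `x̂_i = median_u s_u(i) y_{u,h_u(i)}`. -/
noncomputable def estimate (ω : CountSketchSeed n R C) (x : Fin n → ℝ) (i : Fin n) : ℝ :=
  median fun u => ((ω.2 u i : ℤ) : ℝ) * ω.sketch x u (ω.1 u i)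

end CountSketchSeed

/-- Every set of signs is measurable, so that all events below are measurable. -/
instance : MeasurableSingletonClass ℤˣ where
  measurableSet_singleton u := by
    have h : ({u} : Set ℤˣ) = Units.val ⁻¹' {(u : ℤ)} := by
      ext v
      simp [Units.ext_iff]
    rw [h]
    exact comap_measurable _ (measurableSet_singleton _)

/-- The law of the random choices of one Count-Sketch with fully random hash functions: all pairs
`(h, s)` are equally likely. -/
noncomputable def countSketchLaw (n R C : ℕ) : Measure (CountSketchSeed n R C) :=
  uniformOn Set.univ

/-- The law of the random choices of `r` independent Count-Sketches. -/
noncomputable def parallelLaw (r n R C : ℕ) : Measure (Fin r → CountSketchSeed n R C) :=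
  Measure.pi fun _ => countSketchLaw n R C

/-- The coordinate-wise median of the estimates of `r` Count-Sketches of the vector `x`. -/
noncomputable def parallelEstimate {r n R C : ℕ} (ω : Fin r → CountSketchSeed n R C)
    (x : Fin n → ℝ) (i : Fin n) : ℝ :=
  median fun a => (ω a).estimate x i

set_option linter.unusedSectionVars false

namespace SketchBound

/-! ### Finite product laws -/

/-! A single Count-Sketch fails on `S` with probability O(1/|S|). If the coordinate-wise median of
`56d` sketches has large error, then at least half of the sketches do. So `28d` of them fail
together, which costs at most `2^(56d) * O(1/|S|)^(28d)`.

For one sketch, put m = |S| and let σ² dominate 16‖tail‖²/C. Every squared error is truncated at σ²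
and measured in units of σ²/R (`level`). The truncated errors of p ≈ (log m)/4 coordinates have
exponential moments as if they were independent (`integral_exp_sum_level_le`). Averaging over all
p-subsets of `S` with Jensen, then Markov, bounds the whole truncated sum by O(m) up to probability
O(1/m) (`measureReal_le_of_exp_moment`). Errors beyond a constant multiple of σ are excluded by a
Chernoff bound per coordinate and a union bound (`measureReal_le_abs_err_le`); there R ≥ ρ log k
supplies the probability O(1/m²).

The exponential moments come from the rows. A median error of at least ησ forces half of the rows to
have noise at least ησ with the same sign, so a product over rows of centred exponential weights
(`tilt`) is at least 1. The rows are independent, so it suffices to bound the mean in one row of the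
product of the weights over the p coordinates, by exp(-∑η²/512) (`integral_prod_tilt_noise_le`). If
the coordinates lie in distinct buckets, the buckets are revealed one by one and each contributes a
factor exp(-η²/256). Collisions are rare because C exceeds 20 exp(4p), and on them a sign flip
removes the first-order term of the weight, leaving a cost proportional to ∑η².

The factor for one bucket rests on a small-ball estimate: the noise is within ησ of 0 with
probability at least η/8. A signed random hit is distributed as the difference of two independent
Bernoulli variables, so the noise is the difference of two independent copies of a random subset
sum. That sum is concentrated by Chebyshev, and two copies of a concentrated variable are often
close by pigeonhole (`le_measureReal_abs_hitSum_lt`). -/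

theorem measure_ext_of_integral {α : Type*} [MeasurableSpace α] [MeasurableSingletonClass α]
    [Countable α] {μ ν : Measure α} [IsFiniteMeasure μ] [IsFiniteMeasure ν]
    (h : ∀ f : α → ℝ, ∫ a, f a ∂μ = ∫ a, f a ∂ν) : μ = ν := by
  refine Measure.ext_of_singleton fun a => ?_
  have h1 := h (Set.indicator {a} 1)
  rw [integral_indicator_one (measurableSet_singleton a),
    integral_indicator_one (measurableSet_singleton a)] at h1
  exact (measureReal_eq_measureReal_iff).1 h1

theorem integral_pi_map {ι α β : Type*} [Fintype ι] [Finite α] [Countable β]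
    [MeasurableSpace α] [MeasurableSingletonClass α] [MeasurableSpace β]
    [MeasurableSingletonClass β] {μ : Measure α} [IsFiniteMeasure μ] {ν : Measure β} (g : α → β)
    (h : μ.map g = ν) (f : (ι → β) → ℝ) :
    ∫ z, f z ∂(Measure.pi fun _ : ι => ν) = ∫ z, f (fun j => g (z j)) ∂(Measure.pi fun _ => μ) := by
  subst h
  rw [← Measure.pi_map_pi (fun _ => Measurable.of_discrete.aemeasurable),
    integral_map Measurable.of_discrete.aemeasurable
      Measurable.of_discrete.aestronglyMeasurable]

theorem integral_pi_map_prod {ι α β γ : Type*} [Fintype ι] [Finite α] [Finite β] [Countable γ]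
    [MeasurableSpace α] [MeasurableSingletonClass α] [MeasurableSpace β]
    [MeasurableSingletonClass β] [MeasurableSpace γ] [MeasurableSingletonClass γ]
    {μ : Measure α} {ν : Measure β} [IsFiniteMeasure μ] [IsFiniteMeasure ν] {ξ : Measure γ}
    (g : α × β → γ) (h : (μ.prod ν).map g = ξ) (f : (ι → γ) → ℝ) :
    ∫ z, f z ∂(Measure.pi fun _ : ι => ξ) =
      ∫ a, ∫ b, f (fun j => g (a j, b j)) ∂(Measure.pi fun _ => ν) ∂(Measure.pi fun _ => μ) := by
  rw [integral_pi_map g h,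
    ← integral_prod (f := fun p : (ι → α) × (ι → β) => f fun j => g (p.1 j, p.2 j))
      Integrable.of_finite,
    ← (measurePreserving_arrowProdEquivProdArrow α β ι (fun _ => μ) (fun _ => ν)).integral_comp']
  rfl

/-- The law of a Boolean that is `true` with probability `q`. -/
noncomputable def bern (q : ℝ) : Measure Bool :=
  ENNReal.ofReal q • Measure.dirac true + ENNReal.ofReal (1 - q) • Measure.dirac false

instance (q : ℝ) : IsFiniteMeasure (bern q) := by
  unfold bern
  have (r : ℝ) (b : Bool) : IsFiniteMeasure (ENNReal.ofReal r • Measure.dirac b) :=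
    Measure.smul_finite _ ENNReal.ofReal_ne_top
  infer_instance

theorem integral_bern {q : ℝ} (h0 : 0 ≤ q) (h1 : q ≤ 1) (f : Bool → ℝ) :
    ∫ b, f b ∂(bern q) = q * f true + (1 - q) * f false := by
  have (r : ℝ) (b : Bool) : IsFiniteMeasure (ENNReal.ofReal r • Measure.dirac b) :=
    Measure.smul_finite _ ENNReal.ofReal_ne_top
  unfold bern
  rw [integral_add_measure Integrable.of_finite Integrable.of_finite, integral_smul_measure,
    integral_smul_measure, integral_dirac, integral_dirac, ENNReal.toReal_ofReal h0,
    ENNReal.toReal_ofReal (by linarith)]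
  rfl

theorem isProbabilityMeasure_bern {q : ℝ} (h0 : 0 ≤ q) (h1 : q ≤ 1) :
    IsProbabilityMeasure (bern q) := by
  have h := integral_bern h0 h1 (fun _ => 1)
  simp only [integral_const, smul_eq_mul, mul_one] at h
  constructor
  have h2 : (bern q).real Set.univ = 1 := by linarith
  rwa [measureReal_def, ENNReal.toReal_eq_one_iff] at h2

theorem integral_uniformOn {α : Type*} [Fintype α] [MeasurableSpace α]
    [MeasurableSingletonClass α] (B : Finset α) (f : α → ℝ) :
    ∫ a, f a ∂(uniformOn (B : Set α)) = (B.card : ℝ)⁻¹ * ∑ a ∈ B, f a := by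
  classical
  have : IsFiniteMeasure (uniformOn (B : Set α)) := by
    unfold uniformOn; infer_instance
  rw [integral_fintype Integrable.of_finite, Finset.mul_sum,
    ← Finset.sum_subset (Finset.subset_univ B)]
  · refine Finset.sum_congr rfl fun a ha => ?_
    have : uniformOn (B : Set α) {a} = (B.card : ENNReal)⁻¹ := by
      have h := uniformOn_apply_finset (s := B) (t := {a})
      rw [Finset.inter_singleton_of_mem ha] at h
      simpa using h
    rw [measureReal_def, this]
    simp
  · intro a _ ha
    have : uniformOn (B : Set α) {a} = 0 := by
      have h := uniformOn_apply_finset (s := B) (t := {a})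
      rw [Finset.inter_singleton_of_notMem ha] at h
      simpa using h
    rw [measureReal_def, this]
    simp

/-- The law of a uniformly random sign. -/
noncomputable def signLaw : Measure ℤˣ := uniformOn Set.univ

instance : IsProbabilityMeasure signLaw := by unfold signLaw; infer_instance

theorem integral_signLaw (f : ℤˣ → ℝ) : ∫ s, f s ∂signLaw = (f 1 + f (-1)) / 2 := by
  have h := integral_uniformOn (Finset.univ : Finset ℤˣ) f
  rw [Finset.coe_univ] at h
  rw [signLaw, h]
  have : (Finset.univ : Finset ℤˣ) = {1, -1} := rfl
  rw [this]
  simp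
  ring

/-- The law of a uniformly random element of `B` together with an independent random sign. -/
noncomputable def itemLaw {κ : Type*} [MeasurableSpace κ] (B : Finset κ) : Measure (κ × ℤˣ) :=
  (uniformOn (B : Set κ)).prod signLaw

theorem isProbabilityMeasure_itemLaw {κ : Type*} [MeasurableSpace κ]
    [MeasurableSingletonClass κ] {B : Finset κ} (hB : B.Nonempty) :
    IsProbabilityMeasure (itemLaw B) := by
  have : IsProbabilityMeasure (uniformOn (B : Set κ)) :=
    isProbabilityMeasure_uniformOn B.finite_toSet (by simpa using hB)
  unfold itemLaw; infer_instance

section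
variable {κ : Type*} [Fintype κ] [MeasurableSpace κ] [MeasurableSingletonClass κ]

instance (B : Finset κ) : IsFiniteMeasure (uniformOn (B : Set κ)) := by
  unfold uniformOn; infer_instance

instance (B : Finset κ) : IsFiniteMeasure (itemLaw B) := by
  unfold itemLaw; infer_instance

theorem integral_itemLaw (B : Finset κ) (f : κ × ℤˣ → ℝ) :
    ∫ a, f a ∂(itemLaw B) = (B.card : ℝ)⁻¹ * ∑ v ∈ B, (f (v, 1) + f (v, -1)) / 2 := by
  rw [itemLaw, integral_prod _ Integrable.of_finite, integral_uniformOn]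
  simp only [integral_signLaw]

/-- The law of an item seen from one of `c` equally likely buckets: whether it falls into the
bucket, and its sign. -/
noncomputable def hitLaw (c : ℕ) : Measure (Bool × ℤˣ) := (bern (1 / c)).prod signLaw

instance (c : ℕ) : IsFiniteMeasure (hitLaw c) := by unfold hitLaw; infer_instance

theorem one_div_natCast_mem (c : ℕ) : 0 ≤ 1 / (c : ℝ) ∧ 1 / (c : ℝ) ≤ 1 := by
  refine ⟨by positivity, ?_⟩
  rw [one_div]
  exact Nat.cast_inv_le_one c

theorem isProbabilityMeasure_hitLaw (c : ℕ) : IsProbabilityMeasure (hitLaw c) := by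
  have := isProbabilityMeasure_bern (one_div_natCast_mem c).1 (one_div_natCast_mem c).2
  unfold hitLaw; infer_instance

theorem integral_hitLaw (c : ℕ) (f : Bool × ℤˣ → ℝ) :
    ∫ a, f a ∂(hitLaw c) = 1 / c * ((f (true, 1) + f (true, -1)) / 2) +
      (1 - 1 / c) * ((f (false, 1) + f (false, -1)) / 2) := by
  rw [hitLaw, integral_prod _ Integrable.of_finite,
    integral_bern (one_div_natCast_mem c).1 (one_div_natCast_mem c).2]
  simp only [integral_signLaw]

/-- Revealing one bucket: a random item lies in bucket `v`, or else in a random other bucket. -/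
theorem map_hitLaw_prod_itemLaw [DecidableEq κ] {B : Finset κ} {v : κ} (hv : v ∈ B)
    (hB : 2 ≤ B.card) :
    ((hitLaw B.card).prod (itemLaw (B.erase v))).map
      (fun p => if p.1.1 then (v, p.1.2) else p.2) = itemLaw B := by
  have := isProbabilityMeasure_hitLaw B.card
  have hc : (B.erase v).card = B.card - 1 := Finset.card_erase_of_mem hv
  have := isProbabilityMeasure_itemLaw (B := B.erase v) (Finset.card_pos.1 (by omega))
  refine measure_ext_of_integral fun f => ?_
  rw [integral_map Measurable.of_discrete.aemeasurable
      Measurable.of_discrete.aestronglyMeasurable, integral_prod _ Integrable.of_finite,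
    integral_hitLaw]
  simp only [if_true, Bool.false_eq_true, if_false, integral_const, probReal_univ, one_smul]
  rw [integral_itemLaw, integral_itemLaw, hc, ← Finset.add_sum_erase _ _ hv, Nat.cast_sub (by omega)]
  have h2 : (2 : ℝ) ≤ B.card := by exact_mod_cast hB
  have h3 : (B.card : ℝ) - 1 ≠ 0 := by linarith
  have h4 : (B.card : ℝ) ≠ 0 := by linarith
  push_cast
  field_simp
  ring

end

/-- Both sides take the values ±1 with probability q(1-q) = 1/(2c) each. This symmetrization turns
the noise of a bucket into a difference of two independent subset sums. -/
theorem map_bern_prod_bern {c : ℕ} {q : ℝ} (h0 : 0 ≤ q) (h1 : q ≤ 1)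
    (hq : q * (1 - q) = 1 / (2 * c)) :
    ((bern q).prod (bern q)).map
      (fun p => ((if p.1 then 1 else 0) - (if p.2 then 1 else 0) : ℤ)) =
    (hitLaw c).map (fun p => if p.1 then (p.2 : ℤ) else 0) := by
  refine measure_ext_of_integral fun f => ?_
  rw [integral_map Measurable.of_discrete.aemeasurable
      Measurable.of_discrete.aestronglyMeasurable, integral_map Measurable.of_discrete.aemeasurable
      Measurable.of_discrete.aestronglyMeasurable, integral_prod _ Integrable.of_finite,
      integral_hitLaw, integral_bern h0 h1]
  simp only [integral_bern h0 h1]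
  simp
  have : (c : ℝ)⁻¹ = 2 * (q * (1 - q)) := by rw [hq]; field_simp
  rw [this]
  ring

/-! ### The noise in a single bucket -/

/-- Two independent copies of a variable that is likely to lie in an interval are likely to be
close to each other. -/
theorem sq_div_le_measureReal_abs_sub_lt {α : Type*} [Finite α] [MeasurableSpace α]
    [MeasurableSingletonClass α] (ν : Measure α) [IsFiniteMeasure ν] (Y : α → ℝ) (G : Set α)
    {a w ε : ℝ} (hε : 0 < ε) (hG : ∀ z ∈ G, |Y z - a| < w) (M : ℕ) (hM : 2 * w ≤ M * ε) :
    ν.real G ^ 2 / M ≤ (ν.prod ν).real {p | |Y p.1 - Y p.2| < ε} := by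
  classical
  -- Cells of length ε: at most M of them meet the interval of radius w, and two values in one cell
  -- differ by less than ε. By Cauchy–Schwarz both copies share a cell with probability at least
  -- `ν.real G ^ 2 / M`.
  let b : α → ℕ := fun z => ⌊(Y z - a + w) / ε⌋₊
  let E : ℕ → Set α := fun i => G ∩ {z | b z = i}
  have hb (z) (hz : z ∈ G) : (b z : ℝ) ≤ (Y z - a + w) / ε ∧ (Y z - a + w) / ε < b z + 1 := by
    have := (abs_lt.1 (hG z hz)).1
    exact ⟨Nat.floor_le (div_nonneg (by linarith) hε.le), Nat.lt_floor_add_one _⟩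
  have hdisj : (Finset.range M : Set ℕ).PairwiseDisjoint E := by
    intro i _ j _ hij
    refine Set.disjoint_left.2 fun z hz hz' => hij ?_
    exact hz.2.symm.trans hz'.2
  have hsum : ν.real G = ∑ i ∈ Finset.range M, ν.real (E i) := by
    rw [← measureReal_biUnion_finset hdisj (fun _ _ => .of_discrete)]
    congr 1
    ext z
    simp only [Set.mem_iUnion, Finset.mem_range, exists_prop]
    refine ⟨fun hz => ⟨b z, ?_, hz, rfl⟩, fun ⟨_, _, hz⟩ => hz.1⟩
    have h1 := (hb z hz).1
    rw [le_div_iff₀ hε] at h1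
    have := (abs_lt.1 (hG z hz)).2
    have : (b z : ℝ) < M := by
      by_contra hcon
      push Not at hcon
      nlinarith
    exact_mod_cast this
  have hcs : ν.real G ^ 2 ≤ M * ∑ i ∈ Finset.range M, ν.real (E i) ^ 2 := by
    have h := sq_sum_le_card_mul_sum_sq (s := Finset.range M) (f := fun i => ν.real (E i))
    rw [← hsum, Finset.card_range] at h
    exact h
  have hle : ∑ i ∈ Finset.range M, ν.real (E i) ^ 2 ≤
      (ν.prod ν).real {p | |Y p.1 - Y p.2| < ε} := by
    have h1 : ∀ i, ν.real (E i) ^ 2 = (ν.prod ν).real (E i ×ˢ E i) := by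
      intro i
      rw [measureReal_prod_prod, sq]
    simp only [h1]
    rw [← measureReal_biUnion_finset _ (fun _ _ => .of_discrete)]
    · refine measureReal_mono ?_
      intro p hp
      simp only [Set.mem_iUnion, Finset.mem_range, exists_prop] at hp
      obtain ⟨i, _, ⟨h1, h2⟩, h3, h4⟩ := hp
      have e1 := hb _ h1
      have e2 := hb _ h3
      simp only [Set.mem_ofPred_eq] at h2 h4 ⊢
      rw [h2] at e1
      rw [h4] at e2
      have : |(Y p.1 - a + w) / ε - (Y p.2 - a + w) / ε| < 1 := by
        rw [abs_lt]; constructor <;> linarith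
      rw [← sub_div, abs_div, abs_of_pos hε, div_lt_one hε] at this
      rwa [show Y p.1 - a + w - (Y p.2 - a + w) = Y p.1 - Y p.2 by ring] at this
    · intro i hi j hj hij
      have := hdisj hi hj hij
      exact Set.disjoint_prod.2 (Or.inl this)
  refine div_le_of_le_mul₀ (by positivity) (by positivity) ?_
  rw [mul_comm]
  exact hcs.trans (by gcongr)

section
variable {ι : Type*} [Fintype ι] [DecidableEq ι]

theorem variance_bern {q : ℝ} (h0 : 0 ≤ q) (h1 : q ≤ 1) (a : ℝ) :
    Var[fun b : Bool => if b then a else 0; bern q] = q * (1 - q) * a ^ 2 := by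
  have := isProbabilityMeasure_bern h0 h1
  rw [variance_eq_sub (MemLp.of_discrete)]
  simp [integral_bern h0 h1]
  ring

/-- A random subset sum avoids a small set `H` of indices and is concentrated with good
probability. -/
theorem exists_concentrated {q : ℝ} (h0 : 0 ≤ q) (h1 : q ≤ 1) (x : ι → ℝ) (H : Finset ι) {V w : ℝ}
    (hV : ∑ j ∈ Hᶜ, x j ^ 2 ≤ V) (hw : 0 < w) :
    ∃ (a : ℝ) (G : Set (ι → Bool)),
      (∀ z ∈ G, |(∑ j, if z j then x j else 0) - a| < w) ∧
      1 - (H.card * q + q * (1 - q) * V / w ^ 2) ≤ (Measure.pi fun _ => bern q).real G := by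
  have := isProbabilityMeasure_bern h0 h1
  set ν : Measure (ι → Bool) := Measure.pi fun _ => bern q with hν
  -- Items of `H` are dropped so that only the light ones enter the variance. On the complement of
  -- the event `D` that some item of `H` is chosen, this changes nothing.
  let X : ι → Bool → ℝ := fun j b => if b then (if j ∈ H then 0 else x j) else 0
  let Y : (ι → Bool) → ℝ := ∑ j, fun z => X j (z j)
  have hY : Var[Y; ν] = q * (1 - q) * ∑ j ∈ Hᶜ, x j ^ 2 := by
    rw [variance_sum_pi (fun _ => MemLp.of_discrete), Finset.mul_sum,
      ← Finset.sum_subset (Finset.subset_univ Hᶜ)]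
    · refine Finset.sum_congr rfl fun j hj => ?_
      rw [variance_bern h0 h1, if_neg (by simpa using hj)]
    · intro j _ hj
      rw [variance_bern h0 h1, if_pos (by simpa using hj)]
      ring
  let A : Set (ι → Bool) := {z | w ≤ |Y z - ∫ y, Y y ∂ν|}
  have hA : ν.real A ≤ q * (1 - q) * V / w ^ 2 := by
    have h := meas_ge_le_variance_div_sq (μ := ν) (X := Y) MemLp.of_discrete hw
    rw [hY] at h
    have hq : 0 ≤ q * (1 - q) := mul_nonneg h0 (by linarith)
    refine (ENNReal.toReal_le_of_le_ofReal ?_ h).trans (by gcongr)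
    have : 0 ≤ ∑ j ∈ Hᶜ, x j ^ 2 := Finset.sum_nonneg fun _ _ => sq_nonneg _
    positivity
  have hhit (j : ι) : ν.real {z | z j = true} = q := by
    have h := (measurePreserving_eval (fun _ : ι => bern q) j).measureReal_preimage
      (s := {true}) (MeasurableSet.of_discrete.nullMeasurableSet)
    have h2 : (bern q).real {true} = q := by
      rw [← integral_indicator_one .of_discrete, integral_bern h0 h1]
      simp
    rw [h2] at h
    exact h
  let D : Set (ι → Bool) := ⋃ j ∈ H, {z | z j = true}
  have hD : ν.real D ≤ H.card * q := by
    refine (measureReal_biUnion_finset_le _ _).trans ?_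
    simp [hhit]
  refine ⟨∫ y, Y y ∂ν, (A ∪ D)ᶜ, ?_, ?_⟩
  · intro z hz
    simp only [Set.mem_compl_iff, Set.mem_union, not_or] at hz
    have h2 : (∑ j, if z j then x j else 0) = Y z := by
      simp only [Y, Finset.sum_apply]
      refine Finset.sum_congr rfl fun j _ => ?_
      by_cases hj : j ∈ H
      · have : z j = false := by
          have h3 := hz.2
          simp only [D, Set.mem_iUnion, not_exists] at h3
          simpa using h3 j hj
        simp [X, this]
      · simp [X, hj]
    rw [h2]
    simpa [A] using hz.1
  · rw [probReal_compl_eq_one_sub .of_discrete]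
    have := measureReal_union_le (μ := ν) A D
    linarith

/-- The sum of the signed values of the items that fall into a bucket. -/
def hitSum (x : ι → ℝ) (z : ι → Bool × ℤˣ) : ℝ :=
  ∑ j, if (z j).1 then (((z j).2 : ℤ) : ℝ) * x j else 0

/-- The noise in a bucket falls with good probability into a given neighbourhood of `0`. -/
theorem le_measureReal_abs_hitSum_lt (x : ι → ℝ) (H : Finset ι) {V w ε ξ : ℝ}
    (hV : ∑ j ∈ Hᶜ, x j ^ 2 ≤ V) (hw : 0 < w) (hε : 0 < ε) {c M : ℕ} (hc : 2 ≤ c)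
    (hM : 2 * w ≤ M * ε) (hξ : (H.card : ℝ) / c + V / (2 * c * w ^ 2) ≤ ξ) (hξ1 : ξ ≤ 1) :
    (1 - ξ) ^ 2 / M ≤ (Measure.pi fun _ => hitLaw c).real {z | |hitSum x z| < ε} := by
  have hc' : (2 : ℝ) ≤ c := by exact_mod_cast hc
  have hroot : 0 ≤ 1 - 2 / (c : ℝ) := by
    rw [sub_nonneg, div_le_one (by linarith)]; exact hc'
  -- The smaller root of q(1-q) = 1/(2c), real because c ≥ 2. Being the smaller one it satisfies q ≤
  -- 1/c, which bounds the chance of choosing an item of `H`.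
  obtain ⟨q, h0, h1, hq⟩ : ∃ q : ℝ, 0 ≤ q ∧ q ≤ 1 / 2 ∧ q * (1 - q) = 1 / (2 * c) := by
    refine ⟨(1 - √(1 - 2 / c)) / 2, ?_, ?_, ?_⟩
    · have : √(1 - 2 / (c : ℝ)) ≤ 1 := by
        have : 0 ≤ 2 / (c : ℝ) := by positivity
        exact Real.sqrt_le_one.2 (by linarith)
      linarith
    · have := Real.sqrt_nonneg (1 - 2 / (c : ℝ))
      linarith
    · have := Real.sq_sqrt hroot
      have h3 : (1 : ℝ) / (2 * c) = 2 / c / 4 := by field_simp; norm_num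
      rw [h3]
      nlinarith
  have h1' : q ≤ 1 := by linarith
  have hqc : q ≤ 1 / c := by
    have : (1 : ℝ) / c = 2 * (1 / (2 * c)) := by field_simp
    rw [this, ← hq]
    nlinarith
  have := isProbabilityMeasure_bern h0 h1'
  obtain ⟨a, G, hG, hGp⟩ := exists_concentrated h0 h1' x H hV hw
  have hkey := sq_div_le_measureReal_abs_sub_lt (Measure.pi fun _ => bern q) _ G hε hG M hM
  have hlow : 1 - ξ ≤ (Measure.pi fun _ : ι => bern q).real G := by
    refine le_trans ?_ hGp
    have e1 : (H.card : ℝ) * q ≤ H.card / c := by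
      rw [div_eq_mul_one_div]; gcongr
    have e2 : q * (1 - q) * V / w ^ 2 = V / (2 * c * w ^ 2) := by
      rw [hq]; field_simp
    rw [e2]
    linarith
  have hsq : (1 - ξ) ^ 2 / M ≤ (Measure.pi fun _ : ι => bern q).real G ^ 2 / M := by
    have : 0 ≤ 1 - ξ := by linarith
    gcongr
  refine (hsq.trans hkey).trans (le_of_eq ?_)
  -- The event is expressed through the integer coefficients of the items, the common image of the
  -- two laws being compared.
  let F : (ι → ℤ) → ℝ := fun y => Set.indicator {y : ι → ℤ | |∑ j, (y j : ℝ) * x j| < ε} 1 y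
  have e1 := integral_pi_map (μ := hitLaw c) (fun p => if p.1 then (p.2 : ℤ) else 0) rfl F
  have e2 := integral_pi_map_prod _ (map_bern_prod_bern h0 h1' hq) F
  rw [e1] at e2
  rw [← integral_prod (f := fun p : (ι → Bool) × (ι → Bool) => F fun j =>
    ((if p.1 j then 1 else 0) - (if p.2 j then 1 else 0) : ℤ)) Integrable.of_finite] at e2
  rw [← integral_indicator_one .of_discrete, ← integral_indicator_one .of_discrete]
  refine Eq.trans ?_ (e2.symm.trans ?_)
  · refine integral_congr_ae (.of_forall fun p => ?_)
    have : (∑ j, ((((if p.1 j then 1 else 0) - (if p.2 j then 1 else 0) : ℤ)) : ℝ) * x j) =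
        (∑ j, if p.1 j then x j else 0) - ∑ j, if p.2 j then x j else 0 := by
      rw [← Finset.sum_sub_distrib]
      refine Finset.sum_congr rfl fun j _ => ?_
      split_ifs <;> simp
    simp only [F, Set.indicator_apply, Set.mem_ofPred_eq, this, Pi.one_apply]
  · refine integral_congr_ae (.of_forall fun z => ?_)
    have : (∑ j, ((if (z j).1 then ((z j).2 : ℤ) else 0 : ℤ) : ℝ) * x j) = hitSum x z := by
      refine Finset.sum_congr rfl fun j _ => ?_
      split_ifs <;> simp
    simp only [F, Set.indicator_apply, Set.mem_ofPred_eq, this, Pi.one_apply]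

end

/-! ### Exponential weights of bad rows -/

/-- The exponential weight of the event that the noise `y`, taken with the sign `ζ`, is at least
`ε`. -/
noncomputable def tilt (lam ε : ℝ) (ζ : ℤˣ) (y : ℝ) : ℝ :=
  Real.exp (lam * ((if ε ≤ ((ζ : ℤ) : ℝ) * y then 1 else 0) - 1 / 2))

theorem tilt_pos (lam ε : ℝ) (ζ : ℤˣ) (y : ℝ) : 0 < tilt lam ε ζ y := Real.exp_pos _

theorem integral_tilt_le {α : Type*} [Finite α] [MeasurableSpace α] [MeasurableSingletonClass α]
    {μ : Measure α} [IsProbabilityMeasure μ] {lam ε P : ℝ} (hlam : 0 ≤ lam) {ζ : ℤˣ} {f : α → ℝ}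
    (hP : μ.real {a | ε ≤ ((ζ : ℤ) : ℝ) * f a} ≤ P) :
    ∫ a, tilt lam ε ζ (f a) ∂μ ≤
      Real.exp (-(lam / 2)) + P * (Real.exp (lam / 2) - Real.exp (-(lam / 2))) := by
  have h (a : α) : tilt lam ε ζ (f a) = Real.exp (-(lam / 2)) +
      Set.indicator {a | ε ≤ ((ζ : ℤ) : ℝ) * f a} 1 a *
        (Real.exp (lam / 2) - Real.exp (-(lam / 2))) := by
    simp only [tilt, Set.indicator_apply, Set.mem_ofPred_eq, Pi.one_apply]
    split_ifs
    · rw [one_mul, add_sub_cancel]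
      congr 1
      ring
    · rw [zero_mul, add_zero]
      congr 1
      ring
  simp only [h]
  rw [integral_add Integrable.of_finite Integrable.of_finite, integral_mul_const,
    integral_indicator_one .of_discrete]
  simp only [integral_const, probReal_univ, one_smul]
  have : Real.exp (-(lam / 2)) ≤ Real.exp (lam / 2) := Real.exp_le_exp.2 (by linarith)
  have : 0 ≤ Real.exp (lam / 2) - Real.exp (-(lam / 2)) := by linarith
  gcongr

/-- By symmetry the two tails are equally likely, and together they miss the central event of
probability at least q. -/
theorem measureReal_sign_mul_le {α : Type*} [Finite α] [MeasurableSpace α]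
    [MeasurableSingletonClass α] {μ : Measure α} [IsProbabilityMeasure μ] {f : α → ℝ} {ε q : ℝ}
    (hε : 0 < ε) (hsymm : μ.real {a | ε ≤ f a} = μ.real {a | ε ≤ -f a})
    (hq : q ≤ μ.real {a | |f a| < ε}) (ζ : ℤˣ) :
    μ.real {a | ε ≤ ((ζ : ℤ) : ℝ) * f a} ≤ (1 - q) / 2 := by
  have h1 : μ.real ({a | ε ≤ f a} ∪ {a | ε ≤ -f a} ∪ {a | |f a| < ε}) =
      μ.real {a | ε ≤ f a} + μ.real {a | ε ≤ -f a} + μ.real {a | |f a| < ε} := by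
    rw [measureReal_union _ .of_discrete, measureReal_union _ .of_discrete]
    · refine Set.disjoint_left.2 fun a h1 h2 => ?_
      simp only [Set.mem_ofPred_eq] at h1 h2
      linarith
    · refine Set.disjoint_left.2 fun a h1 h2 => ?_
      simp only [Set.mem_union, Set.mem_ofPred_eq, abs_lt] at h1 h2
      rcases h1 with h1 | h1 <;> linarith [h2.1, h2.2]
  have h2 : μ.real ({a | ε ≤ f a} ∪ {a | ε ≤ -f a} ∪ {a | |f a| < ε}) ≤ 1 := measureReal_le_one
  rcases Int.units_eq_one_or ζ with rfl | rfl
  · simp only [Units.val_one, Int.cast_one, one_mul]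
    linarith
  · simp only [Units.val_neg, Units.val_one, Int.cast_neg, Int.cast_one, neg_mul, one_mul]
    linarith

section
variable {ι : Type*} [Fintype ι]

theorem map_neg_hitLaw (c : ℕ) : (hitLaw c).map (fun p => (p.1, -p.2)) = hitLaw c := by
  refine measure_ext_of_integral fun f => ?_
  rw [integral_map Measurable.of_discrete.aemeasurable
      Measurable.of_discrete.aestronglyMeasurable, integral_hitLaw, integral_hitLaw]
  simp only [neg_neg]
  ring

theorem integral_tilt_hitSum_le [DecidableEq ι] (x : ι → ℝ) {lam ε q : ℝ} (hlam : 0 ≤ lam)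
    (hε : 0 < ε) {c : ℕ} (hq : q ≤ (Measure.pi fun _ => hitLaw c).real {z | |hitSum x z| < ε})
    (ζ : ℤˣ) :
    ∫ z, tilt lam ε ζ (hitSum x z) ∂(Measure.pi fun _ => hitLaw c) ≤
      Real.exp (-(lam / 2)) + (1 - q) / 2 * (Real.exp (lam / 2) - Real.exp (-(lam / 2))) := by
  have := isProbabilityMeasure_hitLaw c
  refine integral_tilt_le hlam (measureReal_sign_mul_le hε ?_ hq ζ)
  rw [← integral_indicator_one .of_discrete, ← integral_indicator_one .of_discrete,
    integral_pi_map _ (map_neg_hitLaw c)]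
  refine integral_congr_ae (.of_forall fun z => ?_)
  have : hitSum x (fun j => ((z j).1, -(z j).2)) = -hitSum x z := by
    simp only [hitSum, ← Finset.sum_neg_distrib]
    refine Finset.sum_congr rfl fun j _ => ?_
    split_ifs <;> simp
  simp only [Set.indicator_apply, Set.mem_ofPred_eq, Pi.one_apply, this]

/-! ### Several buckets -/

/-- The signed sum of the items in bucket `v`. -/
def bucketSum {κ : Type*} [DecidableEq κ] (x : ι → ℝ) (v : κ) (z : ι → κ × ℤˣ) : ℝ :=
  ∑ j, if (z j).1 = v then (((z j).2 : ℤ) : ℝ) * x j else 0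

variable {κ : Type*} [Fintype κ] [DecidableEq κ] [MeasurableSpace κ] [MeasurableSingletonClass κ]

theorem ae_itemLaw_erase (B : Finset κ) (v : κ) :
    ∀ᵐ z ∂(Measure.pi fun _ : ι => itemLaw (B.erase v)), ∀ j, (z j).1 ≠ v := by
  rw [ae_all_iff]
  intro j
  refine (Measure.tendsto_eval_ae_ae (μ := fun _ : ι => itemLaw (B.erase v)) (i := j)).eventually
    (p := fun a => a.1 ≠ v) ?_
  have h : (itemLaw (B.erase v)).real {a | a.1 = v} = 0 := by
    rw [← integral_indicator_one .of_discrete, integral_itemLaw]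
    refine mul_eq_zero_of_right _ (Finset.sum_eq_zero fun a ha => ?_)
    have := Finset.ne_of_mem_erase ha
    simp [this]
  rw [measureReal_eq_zero_iff] at h
  rw [ae_iff]
  simpa using h

/-- Functions of the contents of distinct buckets are bounded in the mean by the product of bounds
that hold for a single bucket and all subsets of the items: the buckets are revealed one by one. -/
theorem integral_prod_bucketSum_le {τ : Type*} [DecidableEq τ] {φ : τ → ℝ → ℝ}
    (hφ : ∀ i y, 0 ≤ φ i y) {g : τ → ℝ} (hg : ∀ i, 0 ≤ g i) (b : τ → κ) {P : (ι → ℝ) → Prop}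
    (hP : ∀ x, P x → ∀ A : ι → Bool, P fun j => if A j then 0 else x j) {c₀ : ℕ} (hc₀ : 1 ≤ c₀)
    (T : Finset τ)
    (hφg : ∀ i ∈ T, ∀ c x, c₀ ≤ c → P x →
      ∫ z, φ i (hitSum x z) ∂(Measure.pi fun _ => hitLaw c) ≤ g i)
    (B : Finset κ) (hb : Set.InjOn b T) (hbB : ∀ i ∈ T, b i ∈ B) (hB : c₀ + T.card ≤ B.card)
    (x : ι → ℝ) (hx : P x) :
    ∫ z, ∏ i ∈ T, φ i (bucketSum x (b i) z) ∂(Measure.pi fun _ => itemLaw B) ≤ ∏ i ∈ T, g i := by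
  induction T using Finset.induction_on generalizing B x with
  | empty =>
    have := isProbabilityMeasure_itemLaw (B := B) (Finset.card_pos.1 (by omega))
    simp
  | insert i T hi ih =>
    have hiB : b i ∈ B := hbB i (Finset.mem_insert_self _ _)
    rw [Finset.card_insert_of_notMem hi] at hB
    have hmix := map_hitLaw_prod_itemLaw hiB (by omega)
    have := isProbabilityMeasure_hitLaw B.card
    rw [integral_pi_map_prod _ hmix, Finset.prod_insert hi]
    have hne : ∀ i' ∈ T, b i' ≠ b i := by
      intro i' hi' h
      have := hb (Finset.mem_insert_of_mem hi') (Finset.mem_insert_self _ _) h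
      exact hi (this ▸ hi')
    have hinner (a : ι → Bool × ℤˣ) :
        ∫ z, ∏ i' ∈ insert i T, φ i' (bucketSum x (b i')
          fun j => if (a j).1 then (b i, (a j).2) else z j)
            ∂(Measure.pi fun _ => itemLaw (B.erase (b i))) ≤
        φ i (hitSum x a) * ∏ i' ∈ T, g i' := by
      have h1 : ∀ᵐ z ∂(Measure.pi fun _ : ι => itemLaw (B.erase (b i))),
          ∏ i' ∈ insert i T, φ i' (bucketSum x (b i')
            fun j => if (a j).1 then (b i, (a j).2) else z j) =
          φ i (hitSum x a) *
            ∏ i' ∈ T, φ i' (bucketSum (fun j => if (a j).1 then 0 else x j) (b i') z) := by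
        filter_upwards [ae_itemLaw_erase B (b i)] with z hz
        rw [Finset.prod_insert hi]
        congr 1
        · congr 1
          refine Finset.sum_congr rfl fun j _ => ?_
          by_cases h : (a j).1 <;> simp [h, hz j]
        · refine Finset.prod_congr rfl fun i' hi' => ?_
          congr 1
          refine Finset.sum_congr rfl fun j _ => ?_
          by_cases h : (a j).1 <;> simp [h, (hne i' hi').symm]
      -- Once the content `a` of bucket `b i` is known, the other items are uniform over the
      -- remaining buckets. The items already placed act as zeros, which is why `P` must survive
      -- zeroing.
      rw [integral_congr_ae h1, integral_const_mul]
      refine mul_le_mul_of_nonneg_left ?_ (hφ _ _)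
      refine ih (fun i' hi' => hφg i' (Finset.mem_insert_of_mem hi')) _
        (hb.mono (by simp)) ?_ ?_ _ (hP x hx fun j => (a j).1)
      · intro i' hi'
        exact Finset.mem_erase.2 ⟨hne i' hi', hbB i' (Finset.mem_insert_of_mem hi')⟩
      · rw [Finset.card_erase_of_mem hiB]
        omega
    refine (integral_mono Integrable.of_finite Integrable.of_finite hinner).trans ?_
    rw [integral_mul_const]
    exact mul_le_mul_of_nonneg_right
      (hφg i (Finset.mem_insert_self _ _) _ _ (by omega) hx)
      (Finset.prod_nonneg fun _ _ => hg _)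

end

/-! ### One row -/

theorem tilt_sign_mul (lam ε : ℝ) (ζ s : ℤˣ) (y : ℝ) :
    tilt lam ε ζ (((s : ℤ) : ℝ) * y) = tilt lam ε (ζ * s) y := by
  simp only [tilt, Units.val_mul, Int.cast_mul, mul_assoc]

theorem tilt_zero (ε : ℝ) (ζ : ℤˣ) (y : ℝ) : tilt 0 ε ζ y = 1 := by
  simp [tilt]

section
variable {ι κ : Type} [Fintype ι] [DecidableEq ι] [Fintype κ] [DecidableEq κ] [MeasurableSpace κ]
  [MeasurableSingletonClass κ]

/-- The error of the estimate of coordinate `i` in one row. -/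
def noise (x : ι → ℝ) (i : ι) (z : ι → κ × ℤˣ) : ℝ :=
  (((z i).2 : ℤ) : ℝ) * ∑ j, if j ≠ i ∧ (z j).1 = (z i).1 then (((z j).2 : ℤ) : ℝ) * x j else 0

/-- The law of one row. -/
noncomputable def rowLaw (ι κ : Type) [Fintype ι] [Fintype κ] [MeasurableSpace κ] :
    Measure (ι → κ × ℤˣ) :=
  Measure.pi fun _ => itemLaw Finset.univ

instance : IsFiniteMeasure (rowLaw ι κ) := by
  unfold rowLaw; infer_instance

instance [Nonempty κ] : IsProbabilityMeasure (rowLaw ι κ) := by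
  have := isProbabilityMeasure_itemLaw (B := (Finset.univ : Finset κ)) Finset.univ_nonempty
  unfold rowLaw; infer_instance

/-- The rows in which the members of `T` lie in distinct buckets. -/
def isolating (κ : Type) (T : Finset ι) : Set (ι → κ × ℤˣ) :=
  {z | Set.InjOn (fun i => (z i).1) T}

/-- Condition on the buckets and signs of `T`. When the buckets are distinct, the noise of each
member is its own sign times the sum of the outside items in its bucket. The sign is absorbed into
`ζ`, and revealing the buckets gives the product bound for every such conditioning. -/
theorem integral_indicator_isolating_le (T : Finset ι) (lam ε : ι → ℝ) (ζ : ι → ℤˣ) {g : ι → ℝ}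
    (hg : ∀ i, 0 ≤ g i) {c₀ k : ℕ} (hc₀ : 1 ≤ c₀) (hT : c₀ + T.card ≤ Fintype.card κ)
    (x : ι → ℝ) (H : Finset ι) (hH : H.card ≤ k) {V : ℝ} (hV : ∑ j ∈ Hᶜ, x j ^ 2 ≤ V)
    (hφ : ∀ i ∈ T, ∀ (ζ' : ℤˣ) (x' : {j // j ∉ T} → ℝ) (H' : Finset {j // j ∉ T}) (c : ℕ),
      H'.card ≤ k → ∑ j ∈ H'ᶜ, x' j ^ 2 ≤ V → c₀ ≤ c →
      ∫ z, tilt (lam i) (ε i) ζ' (hitSum x' z) ∂(Measure.pi fun _ => hitLaw c) ≤ g i) :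
    ∫ z, (isolating κ T).indicator
        (fun z => ∏ i ∈ T, tilt (lam i) (ε i) (ζ i) (noise x i z)) z ∂(rowLaw ι κ) ≤
      (rowLaw ι κ).real (isolating κ T) * ∏ i ∈ T, g i := by
  classical
  let e := MeasurableEquiv.piEquivPiSubtypeProd (fun _ : ι => κ × ℤˣ) (fun j => j ∈ T)
  have he : MeasurePreserving e (rowLaw ι κ) ((Measure.pi fun _ => itemLaw Finset.univ).prod
    (Measure.pi fun _ => itemLaw Finset.univ)) := by
    have h := measurePreserving_piEquivPiSubtypeProd
      (fun _ : ι => itemLaw (Finset.univ : Finset κ)) (fun j => j ∈ T)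
    rw [rowLaw]
    convert h
  have hesymm (a b) (j : ι) : e.symm (a, b) j = if h : j ∈ T then a ⟨j, h⟩ else b ⟨j, h⟩ := rfl
  have hsplit (f : (ι → κ × ℤˣ) → ℝ) : ∫ z, f z ∂(rowLaw ι κ) =
      ∫ a, ∫ b, f (e.symm (a, b)) ∂(Measure.pi fun _ => itemLaw Finset.univ)
        ∂(Measure.pi fun _ => itemLaw Finset.univ) := by
    rw [← integral_prod (f := fun p => f (e.symm p)) Integrable.of_finite, ← he.integral_comp']
    simp
  rw [← integral_indicator_one .of_discrete, ← integral_mul_const, hsplit, hsplit]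
  refine integral_mono Integrable.of_finite Integrable.of_finite fun a => ?_
  have hmem (b) : e.symm (a, b) ∈ isolating κ T ↔ Function.Injective fun i => (a i).1 := by
    constructor
    · intro h i j hij
      refine Subtype.ext (h i.2 j.2 ?_)
      simp only [hesymm, i.2, j.2, dif_pos, Subtype.coe_eta]
      exact hij
    · intro h i hi j hj hij
      rw [Finset.mem_coe] at hi hj
      simp only [hesymm, hi, hj, dif_pos] at hij
      exact congrArg Subtype.val (h hij)
  by_cases hinj : Function.Injective fun i => (a i).1
  · have hnoise (b) (i : {j // j ∈ T}) : noise x i (e.symm (a, b)) =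
        (((a i).2 : ℤ) : ℝ) * bucketSum (fun j => x j.1) (a i).1 b := by
      have hi : e.symm (a, b) i = a i := by rw [hesymm, dif_pos i.2]
      rw [noise, hi]
      congr 1
      rw [← Fintype.sum_subtype_add_sum_subtype (fun j => j ∈ T), bucketSum]
      refine (congrArg₂ (· + ·) (Finset.sum_eq_zero fun j _ => ?_)
        (Finset.sum_congr rfl fun j _ => ?_)).trans (zero_add _)
      · refine if_neg fun h => h.1 (congrArg Subtype.val (hinj (a₁ := j) (a₂ := i) ?_))
        have h2 := h.2
        rwa [hesymm, dif_pos j.2] at h2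
      · have hne : (j : ι) ≠ i := fun h => j.2 (h ▸ i.2)
        rw [hesymm, dif_neg j.2]
        simp [hne]
    simp only [Set.indicator_apply, hmem, hinj, if_true, Pi.one_apply, integral_const,
      smul_eq_mul]
    have := isProbabilityMeasure_itemLaw (B := (Finset.univ : Finset κ))
      (Finset.card_pos.1 (by rw [Finset.card_univ]; omega))
    rw [probReal_univ, one_mul, one_mul, ← Finset.prod_coe_sort T g]
    have hprod (b) : ∏ i ∈ T, tilt (lam i) (ε i) (ζ i) (noise x i (e.symm (a, b))) =
        ∏ i : T, tilt (lam i) (ε i) (ζ i * (a i).2)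
          (bucketSum (fun j : {j // j ∉ T} => x j.1) (a i).1 b) := by
      rw [← Finset.prod_coe_sort]
      refine Finset.prod_congr rfl fun i _ => ?_
      rw [hnoise b i, tilt_sign_mul]
    simp only [hprod]
    refine integral_prod_bucketSum_le (φ := fun (i : T) y => tilt (lam i) (ε i) (ζ i * (a i).2) y)
      (g := fun i : T => g i) (fun i y => (tilt_pos _ _ _ y).le) (fun i => hg i)
      (fun i => (a i).1)
      (P := fun x' => ∃ H' : Finset {j // j ∉ T}, H'.card ≤ k ∧ ∑ j ∈ H'ᶜ, x' j ^ 2 ≤ V)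
      ?_ hc₀ Finset.univ ?_ Finset.univ hinj.injOn (fun _ _ => Finset.mem_univ _) ?_ _ ?_
    · rintro x' ⟨H', h1, h2⟩ A
      refine ⟨H', h1, le_trans (Finset.sum_le_sum fun j _ => ?_) h2⟩
      dsimp only
      split_ifs
      · simpa using sq_nonneg (x' j)
      · exact le_rfl
    · rintro i _ c x' hc ⟨H', h1, h2⟩
      exact hφ i i.2 _ x' H' c h1 h2 hc
    · simpa [Finset.card_univ] using hT
    · refine ⟨H.subtype (fun j => j ∉ T), ?_, le_trans ?_ hV⟩
      · rw [Finset.card_subtype]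
        exact (Finset.card_filter_le _ _).trans hH
      · refine (Finset.sum_map _ (Function.Embedding.subtype _) (fun j => x j ^ 2)).symm.le.trans ?_
        refine Finset.sum_le_sum_of_subset_of_nonneg ?_ fun _ _ _ => sq_nonneg _
        intro j hj
        simp only [Finset.mem_map, Finset.mem_compl, Finset.mem_subtype] at hj ⊢
        obtain ⟨j', h1, rfl⟩ := hj
        exact h1
  · simp only [Set.indicator_apply, hmem, hinj, if_false]
    simp

/-! ### Sign flips and rows with collisions -/

/-- Changing the sign of item `i`. -/
def flip (i : ι) (z : ι → κ × ℤˣ) : ι → κ × ℤˣ :=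
  fun j => if j = i then ((z j).1, -(z j).2) else z j

theorem flip_fst (i j : ι) (z : ι → κ × ℤˣ) : (flip i z j).1 = (z j).1 := by
  unfold flip
  split_ifs <;> rfl

theorem map_neg_itemLaw (B : Finset κ) :
    (itemLaw B).map (fun p => (p.1, -p.2)) = itemLaw B := by
  refine measure_ext_of_integral fun f => ?_
  rw [integral_map Measurable.of_discrete.aemeasurable
      Measurable.of_discrete.aestronglyMeasurable, integral_itemLaw, integral_itemLaw]
  simp only [neg_neg, add_comm]

theorem measurePreserving_flip (i : ι) :
    MeasurePreserving (flip i) (rowLaw ι κ) (rowLaw ι κ) := by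
  refine measurePreserving_pi (fun _ : ι => itemLaw (Finset.univ : Finset κ))
    (fun _ : ι => itemLaw (Finset.univ : Finset κ))
    (f := fun j p => if j = i then (p.1, -p.2) else p) fun j => ⟨.of_discrete, ?_⟩
  by_cases h : j = i
  · simp only [h, if_true]
    exact map_neg_itemLaw _
  · simp only [h, if_false]
    exact Measure.map_id

theorem noise_flip (x : ι → ℝ) (i : ι) (z : ι → κ × ℤˣ) :
    noise x i (flip i z) = -noise x i z := by
  unfold noise
  rw [← neg_mul]
  congr 1
  · simp [flip]
  · refine Finset.sum_congr rfl fun j _ => ?_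
    rw [flip_fst, flip_fst]
    by_cases h : j = i
    · simp [h]
    · simp [h, flip]

theorem flip_mem_isolating_iff (i : ι) (T : Finset ι) (z : ι → κ × ℤˣ) :
    flip i z ∈ isolating κ T ↔ z ∈ isolating κ T := by
  simp only [isolating, Set.mem_ofPred_eq, flip_fst]

/-- Flipping the sign of item i negates its noise but moves no item, so noise above ε and noise
below -ε are equally likely even among the rows with collisions. -/
theorem measureReal_inter_noise_le (T : Finset ι) (x : ι → ℝ) (i : ι) {ε : ℝ} (hε : 0 < ε)
    (ζ : ℤˣ) :
    (rowLaw ι κ).real ((isolating κ T)ᶜ ∩ {z | ε ≤ ((ζ : ℤ) : ℝ) * noise x i z}) ≤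
      (rowLaw ι κ).real (isolating κ T)ᶜ / 2 := by
  set μ := rowLaw ι κ
  have h1 : μ.real ((isolating κ T)ᶜ ∩ {z | ε ≤ ((ζ : ℤ) : ℝ) * noise x i z}) =
      μ.real ((isolating κ T)ᶜ ∩ {z | ε ≤ -(((ζ : ℤ) : ℝ) * noise x i z)}) := by
    rw [← (measurePreserving_flip i).measureReal_preimage
      (MeasurableSet.of_discrete.nullMeasurableSet)]
    congr 1
    ext z
    simp only [Set.mem_preimage, Set.mem_inter_iff, Set.mem_compl_iff, flip_mem_isolating_iff,
      Set.mem_ofPred_eq, noise_flip, mul_neg]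
  have h2 : μ.real ((isolating κ T)ᶜ ∩ {z | ε ≤ ((ζ : ℤ) : ℝ) * noise x i z}) +
      μ.real ((isolating κ T)ᶜ ∩ {z | ε ≤ -(((ζ : ℤ) : ℝ) * noise x i z)}) ≤
        μ.real (isolating κ T)ᶜ := by
    rw [← measureReal_union _ .of_discrete]
    · exact measureReal_mono (Set.union_subset Set.inter_subset_left Set.inter_subset_left)
    · refine Set.disjoint_left.2 fun z hz hz' => ?_
      have e1 := hz.2
      have e2 := hz'.2
      simp only [Set.mem_ofPred_eq] at e1 e2
      linarith
  linarith

theorem exp_le_of_abs_le {Y X : ℝ} (h : |Y| ≤ X) :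
    Real.exp Y ≤ 1 + Y + X ^ 2 * Real.exp X := by
  have h1 := Complex.norm_exp_sub_sum_le_norm_mul_exp (Y : ℂ) 2
  have h2 : Complex.exp (Y : ℂ) - ∑ m ∈ Finset.range 2, (Y : ℂ) ^ m / (m.factorial : ℂ) =
      ((Real.exp Y - (1 + Y) : ℝ) : ℂ) := by
    simp [Finset.sum_range_succ]
  rw [h2, Complex.norm_real, Complex.norm_real, Real.norm_eq_abs, Real.norm_eq_abs] at h1
  have h3 : |Y| ^ 2 * Real.exp |Y| ≤ X ^ 2 * Real.exp X := by
    gcongr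
  linarith [le_abs_self (Real.exp Y - (1 + Y))]

/-- The exponent is expanded to second order. Its linear part has nonpositive mean on the collision
event, by the sign-flip symmetry, so only `X ^ 2 * exp X` remains. A coordinate with `lam i = 0` has
constant weight 1 and needs no positive threshold. -/
theorem integral_indicator_compl_isolating_le [Nonempty κ] (T : Finset ι) (x : ι → ℝ)
    {lam ε : ι → ℝ} (ζ : ι → ℤˣ) (hlam : ∀ i ∈ T, 0 ≤ lam i) (hε : ∀ i ∈ T, lam i = 0 ∨ 0 < ε i)
    {X : ℝ} (hX : ∑ i ∈ T, lam i / 2 ≤ X) :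
    ∫ z, (isolating κ T)ᶜ.indicator
        (fun z => ∏ i ∈ T, tilt (lam i) (ε i) (ζ i) (noise x i z)) z ∂(rowLaw ι κ) ≤
      (rowLaw ι κ).real (isolating κ T)ᶜ * (1 + X ^ 2 * Real.exp X) := by
  set N : Set (ι → κ × ℤˣ) := (isolating κ T)ᶜ with hN
  let E : ι → Set (ι → κ × ℤˣ) := fun i => {z | ε i ≤ ((ζ i : ℤ) : ℝ) * noise x i z}
  have hpt (z : ι → κ × ℤˣ) :
      N.indicator (fun z => ∏ i ∈ T, tilt (lam i) (ε i) (ζ i) (noise x i z)) z ≤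
        N.indicator 1 z * (1 + X ^ 2 * Real.exp X) +
        ∑ i ∈ T, lam i * ((N ∩ E i).indicator 1 z - N.indicator 1 z / 2) := by
    classical
    by_cases hz : z ∈ N
    · have hE (i : ι) : (N ∩ E i).indicator (1 : (ι → κ × ℤˣ) → ℝ) z =
          if ε i ≤ ((ζ i : ℤ) : ℝ) * noise x i z then 1 else 0 := by
        simp [Set.indicator_apply, hz, E]
      simp only [hE, Set.indicator_of_mem hz, Pi.one_apply, one_mul, tilt, ← Real.exp_sum]
      refine (exp_le_of_abs_le (X := X) ?_).trans (le_of_eq (by ring))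
      refine (Finset.abs_sum_le_sum_abs _ _).trans
        (le_trans (Finset.sum_le_sum fun i hi => ?_) hX)
      rw [abs_mul, abs_of_nonneg (hlam i hi), div_eq_mul_inv]
      refine mul_le_mul_of_nonneg_left ?_ (hlam i hi)
      split_ifs <;> norm_num [abs_le]
    · simp [hz]
  refine (integral_mono Integrable.of_finite Integrable.of_finite hpt).trans ?_
  rw [integral_add Integrable.of_finite Integrable.of_finite, integral_mul_const,
    integral_indicator_one .of_discrete, integral_finsetSum _ fun _ _ => Integrable.of_finite]
  refine add_le_of_nonpos_right (Finset.sum_nonpos fun i hi => ?_)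
  rw [integral_const_mul, integral_sub Integrable.of_finite Integrable.of_finite,
    integral_div, integral_indicator_one .of_discrete, integral_indicator_one .of_discrete]
  rcases hε i hi with h | h
  · simp [h]
  · exact mul_nonpos_of_nonneg_of_nonpos (hlam i hi)
      (by linarith [measureReal_inter_noise_le (κ := κ) T x i h (ζ i)])

/-- Birthday bound: a union over ordered pairs in `T`. -/
theorem measureReal_compl_isolating_le [Nonempty κ] (T : Finset ι) :
    (rowLaw ι κ).real (isolating κ T)ᶜ ≤ (T.card : ℝ) ^ 2 / Fintype.card κ := by
  have := isProbabilityMeasure_itemLaw (B := (Finset.univ : Finset κ)) Finset.univ_nonempty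
  have hcard : (Fintype.card κ : ℝ) ≠ 0 := by simp
  have hpair (i j : ι) (hij : i ≠ j) : (rowLaw ι κ).real {z | (z i).1 = (z j).1} ≤
      1 / Fintype.card κ := by
    have hcov : {z : ι → κ × ℤˣ | (z i).1 = (z j).1} ⊆
        ⋃ v ∈ (Finset.univ : Finset κ),
          Set.univ.pi fun l => if l ∈ ({i, j} : Finset ι) then {a | a.1 = v} else Set.univ := by
      intro z hz
      simp only [Set.mem_iUnion]
      refine ⟨(z i).1, Finset.mem_univ _, fun l _ => ?_⟩
      dsimp only
      split_ifs with h
      · simp only [Finset.mem_insert, Finset.mem_singleton] at h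
        rcases h with rfl | rfl
        · rfl
        · exact hz.symm
      · trivial
    refine (measureReal_mono hcov (measure_ne_top _ _)).trans ((measureReal_biUnion_finset_le _ _).trans ?_)
    have hv (v : κ) : (itemLaw (Finset.univ : Finset κ)).real {a | a.1 = v} =
        1 / Fintype.card κ := by
      rw [← integral_indicator_one .of_discrete, integral_itemLaw]
      simp [Set.indicator_apply]
    have hbox (v : κ) : (rowLaw ι κ).real (Set.univ.pi fun l =>
        if l ∈ ({i, j} : Finset ι) then {a : κ × ℤˣ | a.1 = v} else Set.univ) =
          (1 / Fintype.card κ) ^ 2 := by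
      rw [rowLaw, measureReal_def, Measure.pi_pi, ENNReal.toReal_prod]
      simp only [← measureReal_def, apply_ite (Measure.real _), hv, probReal_univ]
      rw [Finset.prod_ite_mem, Finset.univ_inter, Finset.prod_const, Finset.card_pair hij]
    simp only [hbox, Finset.sum_const, Finset.card_univ, nsmul_eq_mul]
    refine le_of_eq ?_
    field_simp
  have hcov : (isolating κ T)ᶜ ⊆ ⋃ p ∈ T.offDiag, {z : ι → κ × ℤˣ | (z p.1).1 = (z p.2).1} := by
    intro z hz
    simp only [isolating, Set.InjOn, Set.mem_compl_iff, Set.mem_ofPred_eq, Finset.mem_coe] at hz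
    push Not at hz
    obtain ⟨i, hi, j, hj, h, hne⟩ := hz
    simp only [Set.mem_iUnion]
    exact ⟨(i, j), Finset.mem_offDiag.2 ⟨hi, hj, hne⟩, h⟩
  refine (measureReal_mono hcov (measure_ne_top _ _)).trans ((measureReal_biUnion_finset_le _ _).trans ?_)
  refine (Finset.sum_le_card_nsmul _ _ (1 / (Fintype.card κ : ℝ)) fun p hp =>
    hpair _ _ (Finset.mem_offDiag.1 hp).2.2).trans ?_
  rw [nsmul_eq_mul, mul_one_div]
  have : (T.offDiag.card : ℝ) ≤ (T.card : ℝ) ^ 2 := by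
    rw [Finset.offDiag_card, sq]
    exact_mod_cast Nat.sub_le _ _
  gcongr

end

/-! ### The exponential moment of one row -/

/-- The left side is cosh y - y sinh y, at most exp(y²/2) - y². With y = η/8 it is the mean weight
of a bucket whose noise is small with probability at least y. -/
theorem exp_neg_add_le {y : ℝ} (h0 : 0 ≤ y) (h1 : y ≤ 1) :
    Real.exp (-y) + (1 - y) / 2 * (Real.exp y - Real.exp (-y)) ≤ Real.exp (-(y ^ 2 / 4)) := by
  have h2 : Real.exp (-y) + (1 - y) / 2 * (Real.exp y - Real.exp (-y)) =
      Real.cosh y - y * Real.sinh y := by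
    rw [Real.cosh_eq, Real.sinh_eq]; ring
  have h3 := Real.cosh_le_exp_half_sq y
  have h4 : y * y ≤ y * Real.sinh y := mul_le_mul_of_nonneg_left (Real.self_le_sinh_iff.2 h0) h0
  have hy : y ^ 2 ≤ 1 := by nlinarith
  have h5 := (abs_le.1 (Real.abs_exp_sub_one_sub_id_le (x := y ^ 2 / 2)
    (by rw [abs_of_nonneg (by positivity)]; linarith))).2
  have h6 := Real.add_one_le_exp (-(y ^ 2 / 4))
  nlinarith [sq_nonneg y]

section
variable {ι κ : Type} [Fintype ι] [DecidableEq ι] [Fintype κ] [DecidableEq κ] [MeasurableSpace κ]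
  [MeasurableSingletonClass κ]

theorem integral_tilt_hitSum_le_exp (x : ι → ℝ) (H : Finset ι) {k : ℕ} (hk : 1 ≤ k)
    (hH : H.card ≤ k) {V σ : ℝ} (hV : ∑ j ∈ Hᶜ, x j ^ 2 ≤ V) (hσ : 0 < σ) {c : ℕ}
    (hc : 4 * k ≤ c) (hcV : 8 * V ≤ c * σ ^ 2) {η : ℝ} (h0 : 0 ≤ η) (h1 : η ≤ 1) (ζ : ℤˣ) :
    ∫ z, tilt (η / 4) (η * σ) ζ (hitSum x z) ∂(Measure.pi fun _ => hitLaw c) ≤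
      Real.exp (-(η ^ 2 / 256)) := by
  have := isProbabilityMeasure_hitLaw c
  rcases h0.eq_or_lt with rfl | hη
  · simp [tilt_zero]
  have hcR : 4 * (k : ℝ) ≤ c := by exact_mod_cast hc
  have hk' : (1 : ℝ) ≤ k := by exact_mod_cast hk
  have hHR : (H.card : ℝ) ≤ k := by exact_mod_cast hH
  have hM1 : 1 / η ≤ ⌈1 / η⌉₊ := Nat.le_ceil _
  have hM2 : (⌈1 / η⌉₊ : ℝ) < 1 / η + 1 := Nat.ceil_lt_add_one (by positivity)
  have h1η : 1 ≤ 1 / η := by rw [le_div_iff₀ hη]; linarith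
  -- The subset sum lies within σ/2 of its mean with probability at least 1/2: 1/4 is lost to items
  -- of `H` and 1/4 to Chebyshev. The window of length σ needs ⌈1/η⌉ ≤ 2/η cells of length ησ, which
  -- gives probability at least η/8.
  have hq := le_measureReal_abs_hitSum_lt x H (V := V) (w := σ / 2) (ε := η * σ) (ξ := 1 / 2)
    (c := c) (M := ⌈1 / η⌉₊) hV (by positivity) (by positivity) (by omega) (by
      rw [div_le_iff₀ hη] at hM1
      nlinarith) (by
      have e1 : (H.card : ℝ) / c ≤ 1 / 4 := by
        rw [div_le_iff₀ (by linarith)]; linarith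
      have e2 : V / (2 * c * (σ / 2) ^ 2) ≤ 1 / 4 := by
        have : (0 : ℝ) < c := by linarith
        rw [div_le_iff₀ (by positivity)]; nlinarith
      linarith) (by norm_num)
  have hq2 : η / 8 ≤ (1 - 1 / 2) ^ 2 / (⌈1 / η⌉₊ : ℝ) := by
    rw [le_div_iff₀ (by linarith)]
    have : (⌈1 / η⌉₊ : ℝ) ≤ 2 * (1 / η) := by linarith
    calc η / 8 * (⌈1 / η⌉₊ : ℝ) ≤ η / 8 * (2 * (1 / η)) := by gcongr
      _ = (1 - 1 / 2) ^ 2 := by field_simp; norm_num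
  refine (integral_tilt_hitSum_le x (by positivity) (by positivity) (hq2.trans hq) ζ).trans ?_
  have h := exp_neg_add_le (y := η / 8) (by positivity) (by linarith)
  rw [show η / 4 / 2 = η / 8 by ring]
  refine h.trans (le_of_eq ?_)
  congr 1
  ring

/-- Here S stands for ∑η² and π for the collision probability. The collision cost is itself a
multiple of S, with a factor of order exp(9p/8) that π ≤ exp(-3p)/10 outweighs. It therefore uses up
at most half of the gain S/256. A cost not proportional to S would not survive the R-th power taken
over the rows. -/
theorem collision_cost_le {p C π X S : ℝ} (hp : 0 ≤ p) (hC : 20 * Real.exp (4 * p) ≤ C)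
    (hπ0 : 0 ≤ π) (hπ : π ≤ p ^ 2 / C) (hX : X ≤ p / 8)
    (hXS : X ^ 2 ≤ p * S / 64) (hS0 : 0 ≤ S) (hSp : S ≤ p) :
    (1 - π) * Real.exp (-(S / 256)) + π * (1 + X ^ 2 * Real.exp X) ≤ Real.exp (-(S / 512)) := by
  have hpe : p ≤ Real.exp p := by linarith [Real.add_one_le_exp p]
  have hp2 : p ^ 2 ≤ 2 * Real.exp p := by linarith [Real.quadratic_le_exp_of_nonneg hp]
  have h1 : 1 - S / 256 ≤ Real.exp (-(S / 256)) := by linarith [Real.add_one_le_exp (-(S / 256))]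
  have hCpos : 0 < C := lt_of_lt_of_le (by positivity) hC
  have h2 : Real.exp (-(S / 256)) + Real.exp (-(p / 256)) * (S / 512) ≤
      Real.exp (-(S / 512)) := by
    have e1 : Real.exp (-(S / 512)) = Real.exp (-(S / 256)) * Real.exp (S / 512) := by
      rw [← Real.exp_add]; congr 1; ring
    have e2 : Real.exp (-(p / 256)) ≤ Real.exp (-(S / 256)) := Real.exp_le_exp.2 (by linarith)
    have e3 := Real.add_one_le_exp (S / 512)
    rw [e1]
    nlinarith [Real.exp_pos (-(S / 256))]
  have h3 : π ≤ Real.exp (-(3 * p)) / 10 := by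
    refine hπ.trans ?_
    rw [div_le_iff₀ hCpos]
    have : Real.exp (-(3 * p)) / 10 * (20 * Real.exp (4 * p)) = 2 * Real.exp p := by
      rw [show Real.exp p = Real.exp (-(3 * p)) * Real.exp (4 * p) by
        rw [← Real.exp_add]; congr 1; ring]
      ring
    have h' : 0 ≤ Real.exp (-(3 * p)) / 10 := by positivity
    nlinarith [mul_le_mul_of_nonneg_left hC h']
  have h4 : X ^ 2 * Real.exp X ≤ S * (Real.exp (9 / 8 * p) / 64) := by
    have : Real.exp (9 / 8 * p) = Real.exp p * Real.exp (p / 8) := by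
      rw [← Real.exp_add]; congr 1; ring
    rw [this]
    calc X ^ 2 * Real.exp X ≤ p * S / 64 * Real.exp (p / 8) := by gcongr
      _ ≤ Real.exp p * S / 64 * Real.exp (p / 8) := by gcongr
      _ = _ := by ring
  have h5 : π * (S * (Real.exp (9 / 8 * p) / 64) + S / 256) ≤
      Real.exp (-(p / 256)) * (S / 512) := by
    have e1 : 1 ≤ Real.exp (9 / 8 * p) := Real.one_le_exp (by positivity)
    calc π * (S * (Real.exp (9 / 8 * p) / 64) + S / 256)
        ≤ Real.exp (-(3 * p)) / 10 * (S * (Real.exp (9 / 8 * p) / 64)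
            + S * (Real.exp (9 / 8 * p) / 256)) := by
          gcongr
          nlinarith
      _ = Real.exp (-(15 / 8 * p)) * (S / 512) := by
          rw [show Real.exp (-(15 / 8 * p)) = Real.exp (-(3 * p)) * Real.exp (9 / 8 * p) by
            rw [← Real.exp_add]; congr 1; ring]
          ring
      _ ≤ _ := by
          gcongr
          linarith
  have h6 : π * (1 - Real.exp (-(S / 256))) ≤ π * (S / 256) := by gcongr; linarith
  have h7 : π * (X ^ 2 * Real.exp X) ≤ π * (S * (Real.exp (9 / 8 * p) / 64)) := by gcongr
  linarith

/-- In one row, the exponential weights of a small set of coordinates behave as if they were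
independent. -/
theorem integral_prod_tilt_noise_le [Nonempty κ] (T : Finset ι) {η : ι → ℝ} (h0 : ∀ i, 0 ≤ η i)
    (h1 : ∀ i, η i ≤ 1) (ζ : ι → ℤˣ) (x : ι → ℝ) (H : Finset ι) {k : ℕ} (hk : 1 ≤ k)
    (hH : H.card ≤ k) {V σ : ℝ} (hV : ∑ j ∈ Hᶜ, x j ^ 2 ≤ V) (hσ : 0 < σ)
    (hCk : 8 * k ≤ Fintype.card κ) (hCV : 16 * V ≤ Fintype.card κ * σ ^ 2)
    (hCT : 20 * Real.exp (4 * T.card) ≤ Fintype.card κ) :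
    ∫ z, ∏ i ∈ T, tilt (η i / 4) (η i * σ) (ζ i) (noise x i z) ∂(rowLaw ι κ) ≤
      Real.exp (-((∑ i ∈ T, η i ^ 2) / 512)) := by
  set C := Fintype.card κ with hC
  set μ := rowLaw ι κ
  have hTC : 2 * T.card ≤ C := by
    have := Real.add_one_le_exp (4 * (T.card : ℝ))
    have h : (2 * T.card : ℝ) ≤ C := by
      have : (0 : ℝ) ≤ T.card := by positivity
      linarith
    exact_mod_cast h
  have hCpos : (0 : ℝ) < C := lt_of_lt_of_le (by positivity) hCT
  have hsplit : ∫ z, ∏ i ∈ T, tilt (η i / 4) (η i * σ) (ζ i) (noise x i z) ∂μ =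
      (∫ z, (isolating κ T).indicator
        (fun z => ∏ i ∈ T, tilt (η i / 4) (η i * σ) (ζ i) (noise x i z)) z ∂μ) +
      ∫ z, (isolating κ T)ᶜ.indicator
        (fun z => ∏ i ∈ T, tilt (η i / 4) (η i * σ) (ζ i) (noise x i z)) z ∂μ := by
    rw [← integral_add Integrable.of_finite Integrable.of_finite]
    simp only [Set.indicator_self_add_compl_apply]
  -- While the buckets of `T` are revealed, at least C - |T| ≥ C/2 buckets remain, so the hypotheses
  -- on C pass to every c that occurs with half the constants.
  have hA := integral_indicator_isolating_le (κ := κ) T (fun i => η i / 4) (fun i => η i * σ) ζ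
    (g := fun i => Real.exp (-(η i ^ 2 / 256))) (fun i => (Real.exp_pos _).le)
    (c₀ := C - T.card) (k := k) (by omega) (by omega) x H hH hV (by
      intro i _ ζ' x' H' c hH' hV' hc
      refine integral_tilt_hitSum_le_exp x' H' hk hH' hV' hσ (by omega) ?_ (h0 i) (h1 i) ζ'
      have : (C : ℝ) ≤ 2 * c := by
        have : C ≤ 2 * c := by omega
        exact_mod_cast this
      nlinarith [sq_nonneg σ])
  have hX : ∑ i ∈ T, η i / 4 / 2 = (∑ i ∈ T, η i) / 8 := by
    rw [Finset.sum_div]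
    exact Finset.sum_congr rfl fun i _ => by ring
  have hB := integral_indicator_compl_isolating_le (κ := κ) T x (lam := fun i => η i / 4)
    (ε := fun i => η i * σ) ζ (fun i _ => by have := h0 i; positivity)
    (fun i _ => by
      rcases (h0 i).eq_or_lt with h | h
      · left; rw [← h]; simp
      · right; positivity) hX.le
  rw [hsplit]
  refine (add_le_add hA hB).trans ?_
  rw [← Real.exp_sum, Finset.sum_neg_distrib, ← Finset.sum_div]
  have hcompl : μ.real (isolating κ T) = 1 - μ.real (isolating κ T)ᶜ := by
    rw [probReal_compl_eq_one_sub .of_discrete]; ring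
  rw [hcompl]
  have hsum0 : 0 ≤ ∑ i ∈ T, η i := Finset.sum_nonneg fun i _ => h0 i
  have hsum1 : ∑ i ∈ T, η i ≤ T.card := by
    simpa using Finset.sum_le_card_nsmul T η 1 fun i _ => h1 i
  refine collision_cost_le (p := T.card) (by positivity) hCT measureReal_nonneg
    (measureReal_compl_isolating_le T) (by linarith) ?_
    (Finset.sum_nonneg fun i _ => sq_nonneg _) ?_
  · have := sq_sum_le_card_mul_sum_sq (s := T) (f := η)
    rw [div_pow]
    linarith
  · have := Finset.sum_le_card_nsmul T (fun i => η i ^ 2) 1 fun i _ => by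
      have := h0 i; have := h1 i; nlinarith
    simpa using this

end

/-! ### Medians -/

theorem le_two_mul_card_of_le_median {m : ℕ} {f : Fin m → ℝ} {y : ℝ} (hy : y ≤ median f) :
    m ≤ 2 * (Finset.univ.filter fun u => y ≤ f u).card := by
  rcases Nat.eq_zero_or_pos m with rfl | hm
  · simp
  have hmono := Tuple.monotone_sort f
  let b : Fin m := ⟨m / 2, by omega⟩
  have hb : y ≤ f (Tuple.sort f b) := by
    rw [median, dif_pos hm] at hy
    have : f (Tuple.sort f ⟨(m - 1) / 2, by omega⟩) ≤ f (Tuple.sort f b) :=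
      hmono (Fin.mk_le_mk.2 (by omega))
    simp only [b] at this ⊢
    linarith
  have hsub : (Finset.Ici b).map (Tuple.sort f).toEmbedding ⊆
      Finset.univ.filter fun u => y ≤ f u := by
    intro u hu
    simp only [Finset.mem_map, Finset.mem_Ici, Equiv.coe_toEmbedding] at hu
    obtain ⟨v, hv, rfl⟩ := hu
    simpa using hb.trans (hmono hv)
  have h := Finset.card_le_card hsub
  rw [Finset.card_map, Fin.card_Ici] at h
  simp only [b] at h
  omega

theorem le_two_mul_card_of_median_le {m : ℕ} {f : Fin m → ℝ} {y : ℝ} (hy : median f ≤ y) :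
    m ≤ 2 * (Finset.univ.filter fun u => f u ≤ y).card := by
  rcases Nat.eq_zero_or_pos m with rfl | hm
  · simp
  have hmono := Tuple.monotone_sort f
  let b : Fin m := ⟨(m - 1) / 2, by omega⟩
  have hb : f (Tuple.sort f b) ≤ y := by
    rw [median, dif_pos hm] at hy
    have : f (Tuple.sort f b) ≤ f (Tuple.sort f ⟨m / 2, by omega⟩) :=
      hmono (Fin.mk_le_mk.2 (by omega))
    simp only [b] at this ⊢
    linarith
  have hsub : (Finset.Iic b).map (Tuple.sort f).toEmbedding ⊆
      Finset.univ.filter fun u => f u ≤ y := by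
    intro u hu
    simp only [Finset.mem_map, Finset.mem_Iic, Equiv.coe_toEmbedding] at hu
    obtain ⟨v, hv, rfl⟩ := hu
    simpa using (hmono hv).trans hb
  have h := Finset.card_le_card hsub
  rw [Finset.card_map, Fin.card_Iic] at h
  simp only [b] at h
  omega

/-- A deviation of the median forces at least half of the rows to deviate in the same direction. The
weights are centred at 1/2 so that the total exponent is then nonnegative. -/
theorem one_le_prod_tilt {R : ℕ} {lam ε a : ℝ} (hlam : 0 ≤ lam) (ζ : ℤˣ) (ν : Fin R → ℝ)
    (h : ε ≤ ((ζ : ℤ) : ℝ) * (median (fun u => a + ν u) - a)) :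
    1 ≤ ∏ u, tilt lam ε ζ (ν u) := by
  have hcard : R ≤ 2 * (Finset.univ.filter fun u => ε ≤ ((ζ : ℤ) : ℝ) * ν u).card := by
    rcases Int.units_eq_one_or ζ with rfl | rfl
    · simp only [Units.val_one, Int.cast_one, one_mul] at h ⊢
      have := le_two_mul_card_of_le_median (show a + ε ≤ median (fun u => a + ν u) by linarith)
      simpa using this
    · simp only [Units.val_neg, Units.val_one, Int.cast_neg, Int.cast_one, neg_mul, one_mul] at h ⊢
      have := le_two_mul_card_of_median_le (show median (fun u => a + ν u) ≤ a - ε by linarith)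
      refine this.trans (Nat.mul_le_mul_left 2 (Finset.card_le_card fun u hu => ?_))
      simp only [Finset.mem_filter, Finset.mem_univ, true_and] at hu ⊢
      linarith
  have hR : (R : ℝ) ≤ 2 * (Finset.univ.filter fun u => ε ≤ ((ζ : ℤ) : ℝ) * ν u).card := by
    exact_mod_cast hcard
  simp only [tilt, ← Real.exp_sum]
  rw [← Finset.mul_sum, Finset.sum_sub_distrib, Finset.sum_boole]
  refine Real.one_le_exp (mul_nonneg hlam ?_)
  simp
  linarith

/-- The truncated squared error, on the scale of the typical error of the median of `R` rows. -/
noncomputable def level (R : ℕ) (σ e : ℝ) : ℝ := R * min (e ^ 2 / σ ^ 2) 1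

/-- Round the level down to an integer N and let ζ be the sign of the error. The term (N, ζ) alone
already suffices: its product of weights is at least 1, and `exp β` pays for the rounding. Summing
over all pairs removes the dependence on the outcome. -/
theorem exp_level_le {R : ℕ} (hR : 0 < R) {σ a β : ℝ} (hσ : 0 < σ) (hβ : 0 ≤ β)
    (ν : Fin R → ℝ) :
    Real.exp (β * level R σ (median (fun u => a + ν u) - a)) ≤ Real.exp β *
      ∑ q ∈ Finset.range (R + 1) ×ˢ (Finset.univ : Finset ℤˣ), Real.exp (β * q.1) *
        ∏ u, tilt (√(q.1 / R) / 4) (√(q.1 / R) * σ) q.2 (ν u) := by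
  set e := median (fun u => a + ν u) - a with he
  have hR' : (0 : ℝ) < R := by exact_mod_cast hR
  set N := ⌊level R σ e⌋₊ with hN
  have hl0 : 0 ≤ level R σ e := by unfold level; positivity
  have hN1 : (N : ℝ) ≤ level R σ e := Nat.floor_le hl0
  have hN2 : level R σ e < N + 1 := Nat.lt_floor_add_one _
  have hNR : N ≤ R := by
    have : level R σ e ≤ R := by
      unfold level
      exact mul_le_of_le_one_right hR'.le (min_le_right _ _)
    exact_mod_cast hN1.trans this
  have hthr : √((N : ℝ) / R) * σ ≤ |e| := by
    have h1 : (N : ℝ) / R ≤ e ^ 2 / σ ^ 2 := by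
      rw [div_le_iff₀ hR', mul_comm]
      refine hN1.trans ?_
      unfold level
      gcongr
      exact min_le_left _ _
    refine abs_le_of_sq_le_sq' ?_ (abs_nonneg e) |>.2
    rw [mul_pow, Real.sq_sqrt (by positivity), sq_abs]
    rwa [← le_div_iff₀ (by positivity)]
  obtain ⟨ζ, hζ⟩ : ∃ ζ : ℤˣ, ((ζ : ℤ) : ℝ) * e = |e| := by
    rcases le_total 0 e with h | h
    · exact ⟨1, by simp [abs_of_nonneg h]⟩
    · exact ⟨-1, by simp [abs_of_nonpos h]⟩
  have hone := one_le_prod_tilt (lam := √((N : ℝ) / R) / 4) (by positivity) ζ ν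
    (hthr.trans hζ.symm.le)
  calc Real.exp (β * level R σ e) ≤ Real.exp (β * (1 + N)) :=
        Real.exp_le_exp.2 (mul_le_mul_of_nonneg_left (by linarith) hβ)
    _ = Real.exp β * (Real.exp (β * N) * 1) := by rw [mul_one, ← Real.exp_add]; ring_nf
    _ ≤ _ := by
        refine mul_le_mul_of_nonneg_left ?_ (Real.exp_pos _).le
        refine le_trans (mul_le_mul_of_nonneg_left hone (Real.exp_pos _).le)
          (Finset.single_le_sum (f := fun q : ℕ × ℤˣ => Real.exp (β * q.1) *
            ∏ u, tilt (√(q.1 / R) / 4) (√(q.1 / R) * σ) q.2 (ν u)) (fun q _ => ?_)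
            (a := (N, ζ)) ?_)
        · exact mul_nonneg (Real.exp_pos _).le (Finset.prod_nonneg fun u _ => (tilt_pos _ _ _ _).le)
        · simp only [Finset.mem_product, Finset.mem_range, Finset.mem_univ, and_true]
          omega

/-! ### Averaging over small subsets -/

theorem sum_powersetCard_sum {α : Type*} [DecidableEq α] (S : Finset α) (f : α → ℝ) {p : ℕ}
    (hp : 1 ≤ p) : ∑ T ∈ S.powersetCard p, ∑ i ∈ T, f i =
      ((S.card - 1).choose (p - 1) : ℝ) * ∑ i ∈ S, f i := by
  have h1 : ∑ T ∈ S.powersetCard p, ∑ i ∈ T, f i =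
      ∑ T ∈ S.powersetCard p, ∑ i ∈ S, if i ∈ T then f i else 0 := by
    refine Finset.sum_congr rfl fun T hT => ?_
    rw [Finset.sum_ite_mem, Finset.inter_eq_right.2 (Finset.mem_powersetCard.1 hT).1]
  rw [h1, Finset.sum_comm, Finset.mul_sum]
  refine Finset.sum_congr rfl fun i hi => ?_
  have h2 := Finset.card_filter_powersetCard_subset {i} S p (by simpa using hi) (by simpa using hp)
  simp only [Finset.singleton_subset_iff, Finset.card_singleton] at h2
  rw [← Finset.sum_filter, Finset.sum_const, h2, nsmul_eq_mul]

/-- Exponential moments of sums over small subsets control the sum over the whole set. -/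
theorem measureReal_le_of_exp_moment {Ω α : Type*} [Finite Ω] [MeasurableSpace Ω]
    [MeasurableSingletonClass Ω] (μ : Measure Ω) [IsProbabilityMeasure μ] [DecidableEq α]
    (S : Finset α) (f : α → Ω → ℝ) {p : ℕ} (hp : 1 ≤ p) (hpS : p ≤ S.card) {K : ℝ} (hK : 0 < K)
    (hmom : ∀ T ⊆ S, T.card = p → ∫ ω, Real.exp (∑ i ∈ T, f i ω) ∂μ ≤ K ^ p) (κ : ℝ) :
    μ.real {ω | S.card * (Real.log K + κ) ≤ ∑ i ∈ S, f i ω} ≤ Real.exp (-(κ * p)) := by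
  set P := S.powersetCard p with hP
  have hcard : P.card = S.card.choose p := Finset.card_powersetCard _ _
  have hPpos : (0 : ℝ) < P.card := by
    rw [hcard]; exact_mod_cast Nat.choose_pos hpS
  have hSpos : (0 : ℝ) < S.card := by
    have : 0 < S.card := by omega
    exact_mod_cast this
  have hchoose : (P.card : ℝ) * p = S.card * ((S.card - 1).choose (p - 1) : ℝ) := by
    obtain ⟨p', rfl⟩ : ∃ p', p = p' + 1 := ⟨p - 1, by omega⟩
    obtain ⟨m', hm'⟩ : ∃ m', S.card = m' + 1 := ⟨S.card - 1, by omega⟩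
    rw [hcard, hm']
    have := Nat.add_one_mul_choose_eq m' p'
    simp only [Nat.add_sub_cancel]
    exact_mod_cast this.symm
  -- Each element of S lies in the fraction p/|S| of the p-subsets, so the exponent on the left is
  -- the average of the subset sums.
  have hjensen (ω : Ω) : Real.exp (p / S.card * ∑ i ∈ S, f i ω) ≤
      ∑ T ∈ P, (P.card : ℝ)⁻¹ * Real.exp (∑ i ∈ T, f i ω) := by
    have h := convexOn_exp.map_sum_le (t := P) (w := fun _ => (P.card : ℝ)⁻¹)
      (p := fun T => ∑ i ∈ T, f i ω) (fun _ _ => by positivity)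
      (by rw [Finset.sum_const, nsmul_eq_mul, mul_inv_cancel₀ hPpos.ne'])
      (fun _ _ => Set.mem_univ _)
    simp only [smul_eq_mul] at h
    rw [← Finset.mul_sum, sum_powersetCard_sum S _ hp] at h
    refine le_trans (le_of_eq ?_) h
    congr 1
    rw [← mul_assoc]
    congr 1
    field_simp
    linarith
  have hint : ∫ ω, Real.exp (p / S.card * ∑ i ∈ S, f i ω) ∂μ ≤ K ^ p := by
    refine (integral_mono Integrable.of_finite Integrable.of_finite hjensen).trans ?_
    rw [integral_finsetSum _ fun _ _ => Integrable.of_finite]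
    simp only [integral_const_mul]
    rw [← Finset.mul_sum, inv_mul_le_iff₀ hPpos, ← nsmul_eq_mul]
    refine Finset.sum_le_card_nsmul _ _ _ fun T hT => ?_
    exact hmom T (Finset.mem_powersetCard.1 hT).1 (Finset.mem_powersetCard.1 hT).2
  have hmarkov := mul_meas_ge_le_integral_of_nonneg (μ := μ)
    (f := fun ω => Real.exp (p / S.card * ∑ i ∈ S, f i ω))
    (.of_forall fun _ => (Real.exp_pos _).le) Integrable.of_finite
    (Real.exp (p * (Real.log K + κ)))
  have hset : {ω | S.card * (Real.log K + κ) ≤ ∑ i ∈ S, f i ω} ⊆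
      {ω | Real.exp (p * (Real.log K + κ)) ≤ Real.exp (p / S.card * ∑ i ∈ S, f i ω)} := by
    intro ω hω
    simp only [Set.mem_ofPred_eq] at hω ⊢
    refine Real.exp_le_exp.2 ?_
    calc (p : ℝ) * (Real.log K + κ) = p / S.card * (S.card * (Real.log K + κ)) := by
          field_simp
      _ ≤ _ := by gcongr
  have hfin := (mul_le_mul_of_nonneg_left (measureReal_mono (μ := μ) hset)
    (Real.exp_pos (p * (Real.log K + κ))).le).trans (hmarkov.trans hint)
  have hexp : Real.exp (p * (Real.log K + κ)) = K ^ p * Real.exp (κ * p) := by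
    rw [mul_add, Real.exp_add, Real.exp_nat_mul, Real.exp_log hK, mul_comm κ]
  rw [hexp] at hfin
  rw [Real.exp_neg, ← one_div, le_div_iff₀ (Real.exp_pos _)]
  have hKp : 0 < K ^ p := by positivity
  nlinarith

/-! ### One Count-Sketch -/

section
variable {ι κ : Type} [Fintype ι] [DecidableEq ι] [Fintype κ] [DecidableEq κ] [MeasurableSpace κ]
  [MeasurableSingletonClass κ]

/-- The error of the median of the estimates of coordinate `i` in the rows `ω`. -/
noncomputable def err {R : ℕ} (x : ι → ℝ) (i : ι) (ω : Fin R → ι → κ × ℤˣ) : ℝ :=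
  median (fun u => x i + noise x i (ω u)) - x i

/-- The law of `R` independent rows. -/
noncomputable def rowsLaw (R : ℕ) (ι κ : Type) [Fintype ι] [Fintype κ] [MeasurableSpace κ] :
    Measure (Fin R → ι → κ × ℤˣ) :=
  Measure.pi fun _ => rowLaw ι κ

instance [Nonempty κ] (R : ℕ) : IsProbabilityMeasure (rowsLaw R ι κ) := by
  unfold rowsLaw; infer_instance

theorem integral_rowsLaw_prod {R : ℕ} (f : Fin R → (ι → κ × ℤˣ) → ℝ) :
    ∫ ω, ∏ u, f u (ω u) ∂(rowsLaw R ι κ) = ∏ u, ∫ z, f u z ∂(rowLaw ι κ) :=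
  integral_fintype_prod_eq_prod f

/-- The bound for the exponential moments of the truncated errors, per coordinate. -/
noncomputable def momentConst : ℝ :=
  Real.exp (1 / 1024) * (2 / (1 - Real.exp (-(1 / 1024))))

theorem one_le_momentConst : 1 ≤ momentConst := by
  unfold momentConst
  have h1 : Real.exp (-(1 / 1024)) < 1 := Real.exp_lt_one_iff.2 (by norm_num)
  have h2 := Real.exp_pos (-(1 / 1024))
  have h3 : 1 ≤ Real.exp (1 / 1024) := Real.one_le_exp (by norm_num)
  have h4 : 1 ≤ 2 / (1 - Real.exp (-(1 / 1024))) := by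
    rw [le_div_iff₀ (by linarith)]; linarith
  nlinarith

theorem sum_exp_le (R : ℕ) :
    ∑ q ∈ Finset.range (R + 1) ×ˢ (Finset.univ : Finset ℤˣ),
      Real.exp (-(1 / 1024) * (q.1 : ℝ)) ≤ 2 / (1 - Real.exp (-(1 / 1024))) := by
  have h1 : Real.exp (-(1 / 1024)) < 1 := Real.exp_lt_one_iff.2 (by norm_num)
  have h2 := Real.exp_pos (-(1 / 1024))
  rw [Finset.sum_product]
  simp only [Finset.sum_const, Finset.card_univ, nsmul_eq_mul]
  have h3 : (Fintype.card ℤˣ : ℝ) = 2 := by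
    rw [Fintype.card_units_int]; norm_num
  rw [h3, ← Finset.mul_sum, div_eq_mul_inv (2 : ℝ)]
  refine mul_le_mul_of_nonneg_left ?_ (by norm_num)
  have h4 (l : ℕ) : Real.exp (-(1 / 1024) * (l : ℝ)) = Real.exp (-(1 / 1024)) ^ l := by
    rw [mul_comm, Real.exp_nat_mul]
  simp only [h4]
  rw [← tsum_geometric_of_lt_one h2.le h1]
  exact (summable_geometric_of_lt_one h2.le h1).sum_le_tsum _ fun _ _ => by positivity

/-- The truncated errors of a small set of coordinates have exponential moments as if they were
independent. -/
theorem integral_exp_sum_level_le [Nonempty κ] {R : ℕ} (hR : 0 < R) (T : Finset ι) (x : ι → ℝ)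
    (H : Finset ι) {k : ℕ} (hk : 1 ≤ k) (hH : H.card ≤ k) {V σ : ℝ}
    (hV : ∑ j ∈ Hᶜ, x j ^ 2 ≤ V) (hσ : 0 < σ) (hCk : 8 * k ≤ Fintype.card κ)
    (hCV : 16 * V ≤ Fintype.card κ * σ ^ 2) (hCT : 20 * Real.exp (4 * T.card) ≤ Fintype.card κ) :
    ∫ ω, Real.exp (∑ i ∈ T, 1 / 1024 * level R σ (err x i ω)) ∂(rowsLaw R ι κ) ≤
      momentConst ^ T.card := by
  have hR' : (0 : ℝ) < R := by exact_mod_cast hR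
  set Q := Finset.range (R + 1) ×ˢ (Finset.univ : Finset ℤˣ) with hQ
  let G : ι → ℕ × ℤˣ → (ι → κ × ℤˣ) → ℝ := fun i q z =>
    tilt (√(q.1 / R) / 4) (√(q.1 / R) * σ) q.2 (noise x i z)
  have hpt (ω : Fin R → ι → κ × ℤˣ) :
      Real.exp (∑ i ∈ T, 1 / 1024 * level R σ (err x i ω)) ≤
      Real.exp (1 / 1024) ^ T.card * ∑ a ∈ Fintype.piFinset (fun _ : T => Q),
        (∏ i : T, Real.exp (1 / 1024 * (a i).1)) * ∏ u, ∏ i : T, G i (a i) (ω u) := by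
    rw [Real.exp_sum, ← Finset.prod_coe_sort]
    refine (Finset.prod_le_prod (fun _ _ => (Real.exp_pos _).le) fun i _ =>
      exp_level_le hR hσ (by norm_num) _).trans (le_of_eq ?_)
    rw [Finset.prod_mul_distrib, Finset.prod_const, Finset.card_univ, Fintype.card_coe,
      Finset.prod_univ_sum]
    congr 1
    refine Finset.sum_congr rfl fun a _ => ?_
    rw [Finset.prod_mul_distrib, Finset.prod_comm]
  refine (integral_mono Integrable.of_finite Integrable.of_finite hpt).trans ?_
  rw [integral_const_mul, integral_finsetSum _ fun _ _ => Integrable.of_finite, momentConst,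
    mul_pow]
  refine mul_le_mul_of_nonneg_left ?_ (by positivity)
  have hterm : ∀ a ∈ Fintype.piFinset (fun _ : T => Q),
      ∫ ω, (∏ i : T, Real.exp (1 / 1024 * (a i).1)) * ∏ u, ∏ i : T, G i (a i) (ω u)
        ∂(rowsLaw R ι κ) ≤ ∏ i : T, Real.exp (-(1 / 1024) * ((a i).1 : ℝ)) := by
    intro a ha
    rw [integral_const_mul, integral_rowsLaw_prod fun _ z => ∏ i : T, G i (a i) z,
      Finset.prod_const, Finset.card_univ, Fintype.card_fin]
    -- With η² = l/R for the level l, the row bound exp(-∑η²/512) raised to the power R becomes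
    -- exp(-∑l/512). This beats the factor exp(∑l/1024) and leaves a geometric series in each
    -- coordinate.
    let η : ι → ℝ := fun i => if h : i ∈ T then √((a ⟨i, h⟩).1 / R) else 0
    let ζ : ι → ℤˣ := fun i => if h : i ∈ T then (a ⟨i, h⟩).2 else 1
    have hη (i : T) : η i = √((a i).1 / R) := by simp [η]
    have hζ (i : T) : ζ i = (a i).2 := by simp [ζ]
    have hrow := integral_prod_tilt_noise_le (κ := κ) T (η := η)
      (fun i => by simp only [η]; split_ifs <;> positivity)
      (fun i => by
        simp only [η]
        split_ifs with h
        · refine Real.sqrt_le_one.2 ((div_le_one hR').2 ?_)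
          have := Fintype.mem_piFinset.1 ha ⟨i, h⟩
          simp only [hQ, Finset.mem_product, Finset.mem_range] at this
          exact_mod_cast Nat.lt_succ_iff.1 this.1
        · norm_num) ζ x H hk hH hV hσ hCk hCV hCT
    have hG (z : ι → κ × ℤˣ) : ∏ i ∈ T, tilt (η i / 4) (η i * σ) (ζ i) (noise x i z) =
        ∏ i : T, G i (a i) z := by
      rw [← Finset.prod_coe_sort]
      refine Finset.prod_congr rfl fun i _ => ?_
      rw [hη, hζ]
    simp only [hG] at hrow
    have hsum : ∑ i ∈ T, η i ^ 2 = (∑ i : T, ((a i).1 : ℝ)) / R := by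
      rw [← Finset.sum_coe_sort, Finset.sum_div]
      refine Finset.sum_congr rfl fun i _ => ?_
      rw [hη, Real.sq_sqrt (by positivity)]
    rw [hsum] at hrow
    have hpow : (∫ z, ∏ i : T, G i (a i) z ∂(rowLaw ι κ)) ^ R ≤
        Real.exp (-(1 / 512) * ∑ i : T, ((a i).1 : ℝ)) := by
      refine (pow_le_pow_left₀ (integral_nonneg fun z => Finset.prod_nonneg fun i _ =>
        (tilt_pos _ _ _ _).le) hrow R).trans (le_of_eq ?_)
      rw [← Real.exp_nat_mul]
      congr 1
      field_simp
    refine (mul_le_mul_of_nonneg_left hpow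
      (Finset.prod_nonneg fun _ _ => (Real.exp_pos _).le)).trans (le_of_eq ?_)
    rw [← Real.exp_sum, ← Real.exp_sum, ← Real.exp_add, ← Finset.mul_sum, ← Finset.mul_sum]
    congr 1
    ring
  refine (Finset.sum_le_sum hterm).trans ?_
  rw [← Finset.prod_univ_sum (fun _ : T => Q)
    (fun _ q => Real.exp (-(1 / 1024) * (q.1 : ℝ))), Finset.prod_const, Finset.card_univ,
    Fintype.card_coe]
  exact pow_le_pow_left₀ (Finset.sum_nonneg fun _ _ => (Real.exp_pos _).le) (sum_exp_le R) _

/-- Chernoff for a single coordinate, which is always isolated. A row is bad in a given direction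
with probability at most ξ, by the small-ball bound with one cell (`M = 1`). -/
theorem measureReal_le_abs_err_le [Nonempty κ] (R : ℕ) (i : ι) (x : ι → ℝ) (H : Finset ι) {k : ℕ}
    (hH : H.card ≤ k) {V ε ξ : ℝ} (hV : ∑ j ∈ Hᶜ, x j ^ 2 ≤ V) (hε : 0 < ε)
    (hC : 3 ≤ Fintype.card κ) (hξ0 : 0 < ξ) (hξ1 : ξ ≤ 1)
    (hξ : 2 * (k : ℝ) / Fintype.card κ + 4 * V / (Fintype.card κ * ε ^ 2) ≤ ξ) :
    (rowsLaw R ι κ).real {ω | ε ≤ |err x i ω|} ≤ 2 * (2 * √ξ) ^ R := by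
  set C := Fintype.card κ with hCdef
  have hC' : (3 : ℝ) ≤ C := by exact_mod_cast hC
  have hV0 : 0 ≤ V := (Finset.sum_nonneg fun _ _ => sq_nonneg _).trans hV
  have hs : 0 < √ξ := Real.sqrt_pos.2 hξ0
  have hs1 : √ξ ≤ 1 := Real.sqrt_le_one.2 hξ1
  -- This makes the weights √ξ and 1/√ξ, so the mean weight of a row is at most √ξ + ξ/√ξ = 2√ξ.
  set lam := -(2 * Real.log √ξ) with hlam
  have hlam0 : 0 ≤ lam := by
    have := Real.log_nonpos hs.le hs1
    linarith
  have e1 : Real.exp (-(lam / 2)) = √ξ := by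
    rw [hlam, show -(-(2 * Real.log √ξ) / 2) = Real.log √ξ by ring, Real.exp_log hs]
  have e2 : Real.exp (lam / 2) = (√ξ)⁻¹ := by
    rw [← e1, ← Real.exp_neg, neg_neg]
  have hiso : isolating κ ({i} : Finset ι) = Set.univ := by
    refine Set.eq_univ_of_forall fun z => ?_
    simp [isolating]
  have hrow (ζ : ℤˣ) : ∫ z, tilt lam ε ζ (noise x i z) ∂(rowLaw ι κ) ≤ 2 * √ξ := by
    have h := integral_indicator_isolating_le (κ := κ) {i} (fun _ => lam) (fun _ => ε)
      (fun _ => ζ) (g := fun _ => 2 * √ξ) (fun _ => by positivity) (c₀ := C - 1) (k := k)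
      (by omega) (by simp; omega) x H hH hV (by
        intro _ _ ζ' x' H' c hH' hV' hc
        have hcC : (C : ℝ) ≤ 2 * c := by
          have : C ≤ 2 * c := by omega
          exact_mod_cast this
        have hHk : (H'.card : ℝ) ≤ k := by exact_mod_cast hH'
        have hcpos : (0 : ℝ) < c := by linarith
        have hq := le_measureReal_abs_hitSum_lt x' H' (V := V) (w := ε / 2) (ε := ε) (ξ := ξ)
          (c := c) (M := 1) hV' (by positivity) hε (by omega) (by simp; linarith) (by
            refine le_trans (add_le_add ?_ ?_) hξ
            · rw [div_le_div_iff₀ hcpos (by linarith)]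
              nlinarith
            · rw [div_le_div_iff₀ (by positivity) (by positivity)]
              have : 0 ≤ V * ε ^ 2 := by positivity
              nlinarith) hξ1
        refine (integral_tilt_hitSum_le x' hlam0 hε hq ζ').trans ?_
        rw [e1, e2]
        have h3 : √ξ ≤ (√ξ)⁻¹ := by
          rw [← one_div, le_div_iff₀ hs]; nlinarith
        have h4 : (1 - (1 - ξ) ^ 2 / ((1 : ℕ) : ℝ)) / 2 ≤ ξ := by
          rw [Nat.cast_one, div_one]; nlinarith
        have h5 : ξ * ((√ξ)⁻¹ - √ξ) ≤ √ξ := by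
          have : ξ * (√ξ)⁻¹ = √ξ := by
            rw [← div_eq_mul_inv, Real.div_sqrt]
          rw [mul_sub, this]
          have : 0 ≤ ξ * √ξ := by positivity
          linarith
        have h6 := mul_le_mul_of_nonneg_right h4 (sub_nonneg.2 h3)
        linarith)
    simpa [hiso] using h
  have hone (ζ : ℤˣ) :
      (rowsLaw R ι κ).real {ω | ε ≤ ((ζ : ℤ) : ℝ) * err x i ω} ≤ (2 * √ξ) ^ R := by
    have hpt (ω : Fin R → ι → κ × ℤˣ) :
        Set.indicator {ω | ε ≤ ((ζ : ℤ) : ℝ) * err x i ω} (1 : (Fin R → ι → κ × ℤˣ) → ℝ) ω ≤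
          ∏ u, tilt lam ε ζ (noise x i (ω u)) := by
      by_cases h : ε ≤ ((ζ : ℤ) : ℝ) * err x i ω
      · rw [Set.indicator_of_mem (by exact h)]
        exact one_le_prod_tilt hlam0 ζ _ h
      · rw [Set.indicator_of_notMem (by exact h)]
        exact Finset.prod_nonneg fun u _ => (tilt_pos _ _ _ _).le
    rw [← integral_indicator_one .of_discrete]
    refine (integral_mono Integrable.of_finite Integrable.of_finite hpt).trans ?_
    rw [integral_rowsLaw_prod fun _ z => tilt lam ε ζ (noise x i z), Finset.prod_const,
      Finset.card_univ, Fintype.card_fin]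
    exact pow_le_pow_left₀ (integral_nonneg fun z => (tilt_pos _ _ _ _).le) (hrow ζ) R
  have hcov : {ω : Fin R → ι → κ × ℤˣ | ε ≤ |err x i ω|} ⊆
      {ω | ε ≤ (((1 : ℤˣ) : ℤ) : ℝ) * err x i ω} ∪
        {ω | ε ≤ (((-1 : ℤˣ) : ℤ) : ℝ) * err x i ω} := by
    intro ω hω
    simpa [le_abs] using hω
  refine (measureReal_mono hcov).trans ((measureReal_union_le _ _).trans ?_)
  linarith [hone 1, hone (-1)]

/-- The set estimate for a single Count-Sketch. -/
theorem measureReal_lt_sum_err_sq_le [Nonempty κ] {ρ : ℝ} (hρ : 0 < ρ) {R k : ℕ} (hR : 0 < R)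
    (hk : 1 ≤ k) (hRk : ρ * Real.log k ≤ R) (S : Finset ι) (hS : S.Nonempty) (hSk : S.card ≤ k)
    (x : ι → ℝ) (H : Finset ι) (hH : H.card ≤ k) {V σ : ℝ} (hV : ∑ j ∈ Hᶜ, x j ^ 2 ≤ V)
    (hσ : 0 < σ) (hCk : 20 * k ≤ Fintype.card κ)
    (hCρ : 16 * Real.exp (4 / ρ) * k ≤ Fintype.card κ)
    (hCV : 16 * V ≤ Fintype.card κ * σ ^ 2) :
    (rowsLaw R ι κ).real {ω | 2 * Real.exp (4 / ρ) * (1024 * (Real.log momentConst + 4)) *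
        S.card * σ ^ 2 / R < ∑ i ∈ S, err x i ω ^ 2} ≤ (Real.exp 4 + 2) / S.card := by
  set m : ℝ := (S.card : ℝ) with hm
  have hm1 : 1 ≤ m := by
    rw [hm]
    exact_mod_cast hS.card_pos
  -- For m < exp 4 the bound exceeds 1. Otherwise p = ⌊(log m)/4⌋ is at least 1, and exp(4p) ≤ m ≤ k
  -- gives the collision condition on C.
  rcases lt_or_ge m (Real.exp 4) with hlt | hge
  · refine measureReal_le_one.trans ?_
    rw [le_div_iff₀ (by linarith)]
    linarith
  set C := Fintype.card κ with hC
  have hR' : (0 : ℝ) < R := by exact_mod_cast hR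
  have hk' : (1 : ℝ) ≤ k := by exact_mod_cast hk
  have hmk : m ≤ k := by rw [hm]; exact_mod_cast hSk
  have hlogm : 4 ≤ Real.log m := by
    rw [Real.le_log_iff_exp_le (by linarith)]; exact hge
  set p := ⌊Real.log m / 4⌋₊ with hp
  have hp1 : (p : ℝ) ≤ Real.log m / 4 := Nat.floor_le (by linarith)
  have hp2 : Real.log m / 4 < p + 1 := Nat.lt_floor_add_one _
  have hp3 : 1 ≤ p := Nat.le_floor (by norm_num; linarith)
  have hpS : p ≤ S.card := by
    have h := Real.log_le_sub_one_of_pos (show 0 < m by linarith)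
    have : (p : ℝ) ≤ S.card := by linarith
    exact_mod_cast this
  set E := Real.exp (4 / ρ) with hE
  have hE1 : 1 ≤ E := Real.one_le_exp (by positivity)
  have hCk' : 20 * (k : ℝ) ≤ C := by exact_mod_cast hCk
  have hCpos : (0 : ℝ) < C := by linarith
  set K₂ := 1024 * (Real.log momentConst + 4) with hK₂
  -- the typical errors
  have hmain := measureReal_le_of_exp_moment (rowsLaw R ι κ) S
    (fun i ω => 1 / 1024 * level R σ (err x i ω)) hp3 hpS
    (lt_of_lt_of_le one_pos one_le_momentConst) (fun T _ hTp => by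
      rw [← hTp]
      refine integral_exp_sum_level_le hR T x H hk hH hV hσ (by omega) hCV ?_
      have : Real.exp (4 * T.card) ≤ m := by
        rw [← Real.le_log_iff_exp_le (by linarith), hTp]; linarith
      linarith) 4
  have hexp : Real.exp (-(4 * (p : ℝ))) ≤ Real.exp 4 / m := by
    rw [div_eq_mul_inv, ← Real.exp_log (show 0 < m by linarith), ← Real.exp_neg, ← Real.exp_add]
    exact Real.exp_le_exp.2 (by linarith)
  -- the largest errors
  set L := √(2 * E) with hL
  have hL2 : L ^ 2 = 2 * E := Real.sq_sqrt (by positivity)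
  have hL0 : 0 < L := by positivity
  have htop (i : ι) : (rowsLaw R ι κ).real {ω | L * σ ≤ |err x i ω|} ≤ 2 / m ^ 2 := by
    -- With ξ = 1/(4E) the factor per row is 2√ξ = exp(-2/ρ), and R ≥ ρ log m makes its R-th power
    -- at most 1/m².
    have h := measureReal_le_abs_err_le (κ := κ) R i x H hH (ε := L * σ) (ξ := 1 / (4 * E)) hV
      (by positivity) (by omega) (by positivity)
      (by rw [div_le_one (by positivity)]; linarith) (by
        have e1 : 2 * (k : ℝ) / C ≤ 1 / (8 * E) := by
          rw [div_le_div_iff₀ hCpos (by positivity)]; linarith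
        have e2 : 4 * V / (C * (L * σ) ^ 2) ≤ 1 / (8 * E) := by
          rw [mul_pow, hL2, div_le_div_iff₀ (by positivity) (by positivity)]
          nlinarith
        refine (add_le_add e1 e2).trans (le_of_eq ?_)
        field_simp; norm_num)
    refine h.trans ?_
    have e3 : 2 * √(1 / (4 * E)) = Real.exp (-(2 / ρ)) := by
      have : 1 / (4 * E) = (Real.exp (-(2 / ρ)) / 2) ^ 2 := by
        rw [div_pow, ← Real.exp_nat_mul, hE, one_div, mul_inv, ← Real.exp_neg, div_eq_inv_mul]
        norm_num
        ring_nf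
      rw [this, Real.sqrt_sq (by positivity)]
      ring
    have e4 : Real.exp (-(2 / ρ)) ^ R ≤ 1 / m ^ 2 := by
      have h5 : ρ * Real.log m ≤ R :=
        (mul_le_mul_of_nonneg_left (Real.log_le_log (by linarith) hmk) hρ.le).trans hRk
      have h6 : 1 / m ^ 2 = Real.exp (-(2 * Real.log m)) := by
        rw [Real.exp_neg, ← one_div]
        congr 1
        rw [show 2 * Real.log m = Real.log m + Real.log m by ring, Real.exp_add,
          Real.exp_log (by linarith), sq]
      rw [← Real.exp_nat_mul, h6]
      refine Real.exp_le_exp.2 ?_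
      have h7 : Real.log m ≤ R / ρ := by rw [le_div_iff₀ hρ]; linarith
      have h8 : (R : ℝ) * -(2 / ρ) = -(2 * (R / ρ)) := by ring
      rw [h8]
      linarith
    rw [e3]
    calc 2 * Real.exp (-(2 / ρ)) ^ R ≤ 2 * (1 / m ^ 2) := by gcongr
      _ = 2 / m ^ 2 := by ring
  have hcov : {ω : Fin R → ι → κ × ℤˣ | 2 * E * K₂ * m * σ ^ 2 / R < ∑ i ∈ S, err x i ω ^ 2} ⊆
      {ω | m * (Real.log momentConst + 4) ≤ ∑ i ∈ S, 1 / 1024 * level R σ (err x i ω)} ∪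
        ⋃ i ∈ S, {ω | L * σ ≤ |err x i ω|} := by
    intro ω hω
    by_contra hcon
    simp only [Set.mem_union, Set.mem_iUnion, Set.mem_ofPred_eq, not_or, not_le, not_exists]
      at hcon hω
    obtain ⟨h1, h2⟩ := hcon
    rw [← Finset.mul_sum] at h1
    have h3 : ∀ i ∈ S, err x i ω ^ 2 ≤ 2 * E * σ ^ 2 / R * level R σ (err x i ω) := by
      intro i hi
      have h4 : err x i ω ^ 2 ≤ (L * σ) ^ 2 :=
        (sq_abs (err x i ω)).symm.le.trans (pow_le_pow_left₀ (abs_nonneg _) (h2 i hi).le 2)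
      rw [mul_pow, hL2] at h4
      have h5 : 2 * E * σ ^ 2 / R * level R σ (err x i ω) =
          2 * E * σ ^ 2 * min (err x i ω ^ 2 / σ ^ 2) 1 := by
        unfold level; field_simp
      rw [h5]
      rcases min_choice (err x i ω ^ 2 / σ ^ 2) 1 with h6 | h6 <;> rw [h6]
      · rw [mul_assoc, mul_div_cancel₀ _ (by positivity)]
        nlinarith [sq_nonneg (err x i ω)]
      · linarith
    have h7 := Finset.sum_le_sum h3
    rw [← Finset.mul_sum] at h7
    have h8 : ∑ i ∈ S, level R σ (err x i ω) ≤ m * K₂ := by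
      rw [hK₂]; linarith
    have h9 : 2 * E * σ ^ 2 / R * ∑ i ∈ S, level R σ (err x i ω) ≤
        2 * E * σ ^ 2 / R * (m * K₂) := by gcongr
    have h10 : 2 * E * σ ^ 2 / R * (m * K₂) = 2 * E * K₂ * m * σ ^ 2 / R := by ring
    linarith
  refine (measureReal_mono hcov).trans ((measureReal_union_le _ _).trans ?_)
  have hun : (rowsLaw R ι κ).real (⋃ i ∈ S, {ω | L * σ ≤ |err x i ω|}) ≤ 2 / m := by
    refine (measureReal_biUnion_finset_le _ _).trans
      ((Finset.sum_le_card_nsmul _ _ _ fun i _ => htop i).trans (le_of_eq ?_))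
    rw [nsmul_eq_mul, ← hm]
    field_simp
  rw [add_div]
  exact add_le_add (hmain.trans hexp) hun

end

/-! ### Count-Sketch -/

theorem integral_uniformOn_univ {α : Type*} [Fintype α] [MeasurableSpace α]
    [MeasurableSingletonClass α] (f : α → ℝ) :
    ∫ a, f a ∂(uniformOn Set.univ) = (Fintype.card α : ℝ)⁻¹ * ∑ a, f a := by
  rw [← Finset.coe_univ, integral_uniformOn, Finset.card_univ]

theorem map_uniformOn_univ {α β : Type*} [Fintype α] [Fintype β] [Nonempty α]
    [MeasurableSpace α] [MeasurableSingletonClass α] [MeasurableSpace β]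
    [MeasurableSingletonClass β] (e : α ≃ β) :
    (uniformOn (Set.univ : Set α)).map e = uniformOn Set.univ := by
  have : Nonempty β := e.symm.nonempty_congr.2 ‹_›
  refine measure_ext_of_integral fun f => ?_
  rw [integral_map Measurable.of_discrete.aemeasurable
      Measurable.of_discrete.aestronglyMeasurable, integral_uniformOn_univ,
    integral_uniformOn_univ, Fintype.card_congr e, e.sum_comp]

theorem itemLaw_univ {κ : Type*} [Fintype κ] [Nonempty κ] [MeasurableSpace κ]
    [MeasurableSingletonClass κ] :
    itemLaw (Finset.univ : Finset κ) = uniformOn Set.univ := by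
  refine measure_ext_of_integral fun f => ?_
  rw [integral_itemLaw, integral_uniformOn_univ, Fintype.sum_prod_type, Fintype.card_prod,
    Fintype.card_units_int, Finset.card_univ, Finset.mul_sum, Finset.mul_sum]
  refine Finset.sum_congr rfl fun v _ => ?_
  have : (Finset.univ : Finset ℤˣ) = {1, -1} := rfl
  rw [this, Finset.sum_pair (by decide)]
  push_cast
  rw [mul_inv]
  ring

theorem rowsLaw_eq {R n C : ℕ} [Nonempty (Fin C)] :
    rowsLaw R (Fin n) (Fin C) = uniformOn Set.univ := by
  rw [rowsLaw, rowLaw, itemLaw_univ, ← uniformOn_pi, Set.pi_univ, ← uniformOn_pi, Set.pi_univ]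

/-- The rows of a Count-Sketch. -/
def rowsEquiv (n R C : ℕ) : CountSketchSeed n R C ≃ (Fin R → Fin n → Fin C × ℤˣ) where
  toFun ω u j := (ω.1 u j, ω.2 u j)
  invFun z := (fun u j => (z u j).1, fun u j => (z u j).2)
  left_inv _ := rfl
  right_inv _ := rfl

theorem map_countSketchLaw {R n C : ℕ} [Nonempty (Fin C)] :
    (countSketchLaw n R C).map (rowsEquiv n R C) = rowsLaw R (Fin n) (Fin C) := by
  rw [rowsLaw_eq, countSketchLaw, map_uniformOn_univ]

/-- Item i contributes its sign squared times x i, that is x i, to its own row estimate. -/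
theorem estimate_sub_eq_err {n R C : ℕ} (ω : CountSketchSeed n R C) (x : Fin n → ℝ) (i : Fin n) :
    ω.estimate x i - x i = err x i (rowsEquiv n R C ω) := by
  unfold CountSketchSeed.estimate err
  congr 2
  funext u
  have hs : ((ω.2 u i : ℤ) : ℝ) * ((ω.2 u i : ℤ) : ℝ) = 1 := by
    rcases Int.units_eq_one_or (ω.2 u i) with h | h <;> simp [h]
  simp only [CountSketchSeed.sketch, noise, rowsEquiv, Equiv.coe_fn_mk]
  rw [Finset.sum_filter, ← Finset.add_sum_erase _ _ (Finset.mem_univ i), if_pos rfl, mul_add,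
    ← mul_assoc, hs, one_mul]
  congr 2
  refine Eq.trans (Finset.sum_congr rfl fun j hj => ?_) (Finset.sum_erase Finset.univ (a := i)
    (if_neg fun h => h.1 rfl))
  simp [Finset.ne_of_mem_erase hj]

/-- The indices of the `k` largest coordinates. -/
noncomputable def heavy {n : ℕ} (k : ℕ) (x : Fin n → ℝ) : Finset (Fin n) :=
  Finset.univ.filter fun i => ((Tuple.sort fun j => -|x j|).symm i : ℕ) < k

theorem card_heavy_le {n : ℕ} (k : ℕ) (x : Fin n → ℝ) : (heavy k x).card ≤ k := by
  have h := Finset.card_le_card_of_injOn (s := heavy k x) (t := Finset.range k)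
    (fun i => ((Tuple.sort fun j => -|x j|).symm i : ℕ)) (fun i hi => by
      simpa [heavy] using hi) (fun i _ j _ hij => by
      simpa using Fin.ext hij)
  simpa using h

theorem sum_compl_heavy {n : ℕ} (k : ℕ) (x : Fin n → ℝ) :
    ∑ i ∈ (heavy k x)ᶜ, x i ^ 2 = ∑ i, tail k x i ^ 2 := by
  rw [← Finset.sum_subset (Finset.subset_univ (heavy k x)ᶜ)]
  · refine Finset.sum_congr rfl fun i hi => ?_
    rw [tail, if_neg (by simpa [heavy] using hi)]
  · intro i _ hi
    rw [tail, if_pos (by simpa [heavy] using hi)]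
    norm_num

/-- On a finite space a strict inequality leaves room. The room is spent on making σ positive even
when the tail vanishes. -/
theorem exists_pos_gap {Ω : Type*} [Finite Ω] (f : Ω → ℝ) (b : ℝ) :
    ∃ δ > 0, ∀ ω, b < f ω → b + δ < f ω := by
  by_cases h : Nonempty {ω // b < f ω}
  · obtain ⟨ω₀, h₀⟩ := Finite.exists_min fun ω : {ω // b < f ω} => f ω
    have h1 := ω₀.2
    refine ⟨(f ω₀ - b) / 2, by linarith, fun ω hω => ?_⟩
    have := h₀ ⟨ω, hω⟩
    simp only at this
    linarith
  · exact ⟨1, one_pos, fun ω hω => (h ⟨⟨ω, hω⟩⟩).elim⟩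

/-- The set estimate of a single Count-Sketch fails with probability inversely proportional to the
size of the set. -/
theorem countSketchLaw_real_le {ρ t : ℝ} (hρ : 0 < ρ) {n R C k : ℕ} (hR : 0 < R)
    (hk : 1 ≤ k) (hRk : ρ * Real.log k ≤ R) (S : Finset (Fin n)) (hS : S.Nonempty)
    (hSk : S.card ≤ k) (x : Fin n → ℝ) (hCk : 20 * k ≤ C)
    (hCρ : 16 * Real.exp (4 / ρ) * k ≤ C)
    (hCt : 32 * Real.exp (4 / ρ) * (1024 * (Real.log momentConst + 4)) * k ≤ t * C) :
    (countSketchLaw n R C).real {ω | t * S.card * (1 / R) * ((∑ i, tail k x i ^ 2) / k) <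
        ∑ i ∈ S, (ω.estimate x i - x i) ^ 2} ≤ (Real.exp 4 + 2) / S.card := by
  have : Nonempty (Fin C) := ⟨⟨0, by omega⟩⟩
  have : IsProbabilityMeasure (countSketchLaw n R C) := by
    unfold countSketchLaw; infer_instance
  set V := ∑ i, tail k x i ^ 2 with hVdef
  set W := 2 * Real.exp (4 / ρ) * (1024 * (Real.log momentConst + 4)) with hW
  have hW0 : 0 < W := by
    have := Real.log_nonneg one_le_momentConst
    positivity
  have hV0 : 0 ≤ V := Finset.sum_nonneg fun _ _ => sq_nonneg _
  have hR' : (0 : ℝ) < R := by exact_mod_cast hR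
  have hk' : (0 : ℝ) < k := by exact_mod_cast hk
  have hC' : (0 : ℝ) < C := by
    have : 0 < C := by omega
    exact_mod_cast this
  have hm : (0 : ℝ) < S.card := by exact_mod_cast hS.card_pos
  set m : ℝ := (S.card : ℝ)
  set b := t * m * (1 / R) * (V / k) with hb
  obtain ⟨δ, hδ, hgap⟩ := exists_pos_gap
    (fun z : Fin R → Fin n → Fin C × ℤˣ => ∑ i ∈ S, err x i z ^ 2) b
  -- The second summand is chosen to raise the threshold of the single-sketch estimate by exactly δ.
  have hσpos : 0 < 16 * V / C + δ * R / (W * m) := by positivity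
  set σ := √(16 * V / C + δ * R / (W * m)) with hσ
  have hσ2 : σ ^ 2 = 16 * V / C + δ * R / (W * m) := Real.sq_sqrt hσpos.le
  have hmain := measureReal_lt_sum_err_sq_le (κ := Fin C) hρ hR hk hRk S hS hSk x (heavy k x)
    (card_heavy_le k x) (sum_compl_heavy k x).le (σ := σ) (Real.sqrt_pos.2 hσpos) (by simpa)
    (by simpa) (by
      rw [Fintype.card_fin, hσ2, mul_add, mul_div_cancel₀ _ hC'.ne']
      have : 0 ≤ (C : ℝ) * (δ * R / (W * m)) := by positivity
      linarith)
  refine le_trans ?_ hmain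
  rw [← map_countSketchLaw, map_measureReal_apply .of_discrete .of_discrete]
  refine measureReal_mono ?_ (measure_ne_top _ _)
  intro ω hω
  simp only [Set.mem_ofPred_eq, Set.mem_preimage, estimate_sub_eq_err] at hω ⊢
  refine lt_of_le_of_lt ?_ (hgap _ hω)
  rw [← hW, hσ2]
  have h1 : W * m * (16 * V / C + δ * R / (W * m)) / R = m * V / R * (16 * W / C) + δ := by
    field_simp
  have h2 : 16 * W / C ≤ t / k := by
    rw [div_le_div_iff₀ hC' hk']
    rw [hW]; linarith
  have h3 : b = m * V / R * (t / k) := by rw [hb]; ring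
  rw [h1, h3]
  gcongr

/-! ### Amplification by medians -/

/-- Outside any set of less than half of the indices, some value is at least as far from `a` as the
median. -/
theorem exists_notMem_sq_median_sub_le {r : ℕ} (f : Fin r → ℝ) (a : ℝ) (B : Finset (Fin r))
    (hB : 2 * B.card < r) : ∃ u ∉ B, (median f - a) ^ 2 ≤ (f u - a) ^ 2 := by
  rcases le_total a (median f) with h | h
  · have h1 := le_two_mul_card_of_le_median (le_refl (median f))
    obtain ⟨u, hu, huB⟩ := Finset.exists_mem_notMem_of_card_lt_card
      (s := B) (t := Finset.univ.filter fun u => median f ≤ f u) (by omega)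
    refine ⟨u, huB, pow_le_pow_left₀ (by linarith) ?_ 2⟩
    simp only [Finset.mem_filter, Finset.mem_univ, true_and] at hu
    linarith
  · have h1 := le_two_mul_card_of_median_le (le_refl (median f))
    obtain ⟨u, hu, huB⟩ := Finset.exists_mem_notMem_of_card_lt_card
      (s := B) (t := Finset.univ.filter fun u => f u ≤ median f) (by omega)
    refine ⟨u, huB, ?_⟩
    simp only [Finset.mem_filter, Finset.mem_univ, true_and] at hu
    nlinarith

/-- The coordinate-wise median of several vectors has a large error on `S` only if half of the
vectors do. -/
theorem sum_sq_median_sub_le {r : ℕ} {α : Type*} (S : Finset α) (f : Fin r → α → ℝ) (x : α → ℝ)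
    {b : ℝ} (hb : 0 ≤ b)
    (h : 2 * (Finset.univ.filter fun u => b < ∑ i ∈ S, (f u i - x i) ^ 2).card < r) :
    ∑ i ∈ S, (median (fun u => f u i) - x i) ^ 2 ≤ r * b := by
  set B := Finset.univ.filter fun u => b < ∑ i ∈ S, (f u i - x i) ^ 2 with hB
  -- In each coordinate some good sketch errs at least as much as the median. Which one depends on
  -- the coordinate, so all good sketches are summed, at the price of the factor r.
  calc ∑ i ∈ S, (median (fun u => f u i) - x i) ^ 2
      ≤ ∑ i ∈ S, ∑ u ∈ Bᶜ, (f u i - x i) ^ 2 := by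
        refine Finset.sum_le_sum fun i _ => ?_
        obtain ⟨u, hu, hle⟩ := exists_notMem_sq_median_sub_le (fun u => f u i) (x i) B h
        exact hle.trans (Finset.single_le_sum (f := fun u => (f u i - x i) ^ 2)
          (fun _ _ => sq_nonneg _) (Finset.mem_compl.2 hu))
    _ = ∑ u ∈ Bᶜ, ∑ i ∈ S, (f u i - x i) ^ 2 := Finset.sum_comm
    _ ≤ Bᶜ.card • b := by
        refine Finset.sum_le_card_nsmul _ _ _ fun u hu => ?_
        simpa [hB] using hu
    _ ≤ r * b := by
        rw [nsmul_eq_mul]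
        have h1 : (Bᶜ.card : ℝ) ≤ r := by
          have := Finset.card_le_univ Bᶜ
          rw [Fintype.card_fin] at this
          exact_mod_cast this
        gcongr

/-- Independent repetitions: many of them are bad only with small probability. -/
theorem pi_real_card_le {r h : ℕ} {Ω : Type*} [Finite Ω] [MeasurableSpace Ω]
    [MeasurableSingletonClass Ω] (μ : Measure Ω) [IsProbabilityMeasure μ] (B : Set Ω)
    [DecidablePred (· ∈ B)] :
    (Measure.pi fun _ : Fin r => μ).real
      {ω | h ≤ (Finset.univ.filter fun u => ω u ∈ B).card} ≤ 2 ^ r * μ.real B ^ h := by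
  have hcov : {ω : Fin r → Ω | h ≤ (Finset.univ.filter fun u => ω u ∈ B).card} ⊆
      ⋃ A ∈ (Finset.univ : Finset (Fin r)).powersetCard h,
        Set.univ.pi fun u => if u ∈ A then B else Set.univ := by
    intro ω hω
    obtain ⟨A, hA, hAc⟩ := Finset.exists_subset_card_eq hω
    simp only [Set.mem_iUnion]
    refine ⟨A, Finset.mem_powersetCard.2 ⟨Finset.subset_univ _, hAc⟩, fun u _ => ?_⟩
    dsimp only
    split_ifs with hu
    · simpa using hA hu
    · trivial
  refine (measureReal_mono hcov (measure_ne_top _ _)).trans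
    ((measureReal_biUnion_finset_le _ _).trans ?_)
  have hbox : ∀ A ∈ (Finset.univ : Finset (Fin r)).powersetCard h,
      (Measure.pi fun _ : Fin r => μ).real
        (Set.univ.pi fun u => if u ∈ A then B else Set.univ) ≤ μ.real B ^ h := by
    intro A hA
    rw [measureReal_def, Measure.pi_pi, ENNReal.toReal_prod]
    simp only [← measureReal_def, apply_ite (Measure.real _), probReal_univ]
    rw [Finset.prod_ite_mem, Finset.univ_inter, Finset.prod_const,
      (Finset.mem_powersetCard.1 hA).2]
  refine (Finset.sum_le_card_nsmul _ _ _ hbox).trans ?_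
  rw [nsmul_eq_mul, Finset.card_powersetCard, Finset.card_univ, Fintype.card_fin]
  have : (r.choose h : ℝ) ≤ 2 ^ r := by exact_mod_cast Nat.choose_le_two_pow r h
  gcongr

end SketchBound

theorem mainTheorem9 (t : ℝ) (ht : 0 < t) (d : ℕ) (hd : 0 < d) (ρ : ℝ) (hρ : 0 < ρ) :
    ∃ c₀ A : ℝ, 0 < c₀ ∧ 0 < A ∧
      ∀ (n k R C : ℕ) (c : ℝ), 0 < k → c₀ ≤ c → (C : ℝ) = c * k →
        ρ * Real.log k ≤ R →
        ∀ (x : Fin n → ℝ) (S : Finset (Fin n)), S.card ≤ k →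
          (parallelLaw (56 * d) n R C).real
              {ω | t * S.card * (1 / R) * ((∑ i, tail k x i ^ 2) / k)
                < ∑ i ∈ S, (parallelEstimate ω x i - x i) ^ 2}
            ≤ A / (S.card : ℝ) ^ d := by
  classical
  have hd' : (0 : ℝ) < d := by exact_mod_cast hd
  have hlog := Real.log_nonneg SketchBound.one_le_momentConst
  -- Compensates the factor `56 * d` lost in `sum_sq_median_sub_le`.
  set t' := t / (56 * d) with ht'
  have ht'0 : 0 < t' := by positivity
  set W := 32 * Real.exp (4 / ρ) * (1024 * (Real.log SketchBound.momentConst + 4)) with hW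
  have hW0 : 0 < W := by positivity
  -- The three summands supply `hCk`, `hCρ` and `hCt` respectively.
  set c₀ := 20 + 16 * Real.exp (4 / ρ) + W / t' with hc₀
  set A := 1 + 2 ^ (56 * d) * (Real.exp 4 + 2) ^ (28 * d) with hA
  have hA1 : 1 ≤ A := by
    have : 0 ≤ 2 ^ (56 * d) * (Real.exp 4 + 2) ^ (28 * d) := by positivity
    linarith
  have hE0 := Real.exp_pos (4 / ρ)
  have hWt : 0 < W / t' := by positivity
  refine ⟨c₀, A, by positivity, by positivity, ?_⟩
  intro n k R C c hk hc hC hRk x S hSk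
  have hk' : (1 : ℝ) ≤ k := by exact_mod_cast hk
  have hCk : 20 * (k : ℝ) ≤ C := by rw [hC]; gcongr; linarith
  have hCρ : 16 * Real.exp (4 / ρ) * k ≤ C := by rw [hC]; gcongr; linarith
  have hCt : W * k ≤ t' * C := by
    have : W ≤ t' * c := by
      rw [mul_comm, ← div_le_iff₀ ht'0]; linarith
    rw [hC, ← mul_assoc]
    gcongr
  have hCk2 : 20 * k ≤ C := by exact_mod_cast hCk
  have : Nonempty (Fin C) := ⟨⟨0, by omega⟩⟩
  have : IsProbabilityMeasure (countSketchLaw n R C) := by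
    unfold countSketchLaw; infer_instance
  have : IsProbabilityMeasure (parallelLaw (56 * d) n R C) := by
    unfold parallelLaw; infer_instance
  rcases S.eq_empty_or_nonempty with rfl | hS
  -- For empty S both sides are 0: the event reads 0 < 0, and A / 0 ^ d = 0 since d > 0.
  · simp [hd.ne']
  have hm : (1 : ℝ) ≤ S.card := by exact_mod_cast hS.card_pos
  -- R = 0 forces k = 1, hence |S| = 1, and the bound is A ≥ 1.
  rcases Nat.eq_zero_or_pos R with rfl | hR
  · have h1 : Real.log k ≤ 0 := by
      rw [Nat.cast_zero] at hRk
      exact nonpos_of_mul_nonpos_right hRk hρ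
    have h2 : (k : ℝ) ≤ 1 := by
      by_contra hcon
      linarith [Real.log_pos (not_le.1 hcon)]
    have h3 : (S.card : ℝ) = 1 :=
      le_antisymm ((Nat.cast_le.2 hSk).trans h2) hm
    rw [h3, one_pow, div_one]
    exact measureReal_le_one.trans hA1
  set b := t' * S.card * (1 / R) * ((∑ i, tail k x i ^ 2) / k) with hb
  have hb0 : 0 ≤ b := by
    have : 0 ≤ ∑ i, tail k x i ^ 2 := Finset.sum_nonneg fun _ _ => sq_nonneg _
    positivity
  set B : Set (CountSketchSeed n R C) :=
    {ω | b < ∑ i ∈ S, (ω.estimate x i - x i) ^ 2} with hB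
  have hBle : (countSketchLaw n R C).real B ≤ (Real.exp 4 + 2) / S.card :=
    SketchBound.countSketchLaw_real_le hρ hR hk hRk S hS hSk x hCk2 hCρ hCt
  have hcov : {ω : Fin (56 * d) → CountSketchSeed n R C |
      t * S.card * (1 / R) * ((∑ i, tail k x i ^ 2) / k) <
        ∑ i ∈ S, (parallelEstimate ω x i - x i) ^ 2} ⊆
      {ω | 28 * d ≤ (Finset.univ.filter fun u => ω u ∈ B).card} := by
    intro ω hω
    by_contra hcon
    simp only [Set.mem_ofPred_eq, not_le] at hω hcon
    have h1 := SketchBound.sum_sq_median_sub_le S (fun u i => (ω u).estimate x i) x hb0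
      (by simp only [hB, Set.mem_ofPred_eq] at hcon; omega)
    have h2 : ((56 * d : ℕ) : ℝ) * b =
        t * S.card * (1 / R) * ((∑ i, tail k x i ^ 2) / k) := by
      rw [hb, ht']
      push_cast
      field_simp
    rw [h2] at h1
    exact absurd hω (not_lt.2 h1)
  refine (measureReal_mono hcov (measure_ne_top _ _)).trans
    ((SketchBound.pi_real_card_le _ B).trans ?_)
  calc 2 ^ (56 * d) * (countSketchLaw n R C).real B ^ (28 * d)
      ≤ 2 ^ (56 * d) * ((Real.exp 4 + 2) / S.card) ^ (28 * d) := by gcongr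
    _ = 2 ^ (56 * d) * (Real.exp 4 + 2) ^ (28 * d) / (S.card : ℝ) ^ (28 * d) := by
        rw [div_pow, mul_div_assoc]
    _ ≤ A / (S.card : ℝ) ^ d := by
        gcongr
        · linarith
        · omega
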